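/- Let $S^{n-1}$ be the unit sphere of Euclidean space $\mathbb R^n$. An open hemisphere of $S^{n-1}$ is a set $H(v)=\{x\in S^{n-1} : \langle v,x\rangle>0\}$ with $v\in S^{n-1}$. A subset $V\subseteq S^{n-1}$ is called $m$-tame if every non-empty subset of $V$ with at most $m$ points is contained in some open hemisphere of $S^{n-1}$. A subset $U\subseteq S^{n-1}$ is called weakly maxtame if $U$ is open and $n$-tame, has finitely many connected components, and is maximal with respect to inclusion among the open $n$-tame subsets of $S^{n-1}$ that have at most as many connected components as $U$. Theorem A. Let $U$ be a weakly maxtame subset of $S^{n-1}$. Then there is a finite family $\mathcal H$ of open hemispheres of $S^{n-1}$ such that (i) each connected component of $U$ is the intersection of a non-empty subfamily of $\mathcal H$; and (ii) for each $H\in\mathcal H$, the closure $\overline H$ of $H$ in $S^{n-1}$ has a neighbourhood $N$ in $S^{n-1}$ such that $U\cap H=U\cap N$. Moreover, distinct connected components of $U$ have disjoint closures. -/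

import Mathlib

open scoped Topology

/-- The unit sphere `S^{n-1}` of Euclidean space `ℝⁿ`. -/
abbrev Sph (n : ℕ) : Type := Metric.sphere (0 : EuclideanSpace ℝ (Fin n)) 1

/-- The open hemisphere of `S^{n-1}` centred at `v`. -/
def openHemisphere {n : ℕ} (v : Sph n) : Set (Sph n) :=
  {x | 0 < inner ℝ (v : EuclideanSpace ℝ (Fin n)) (x : EuclideanSpace ℝ (Fin n))}

/-- A set of points is an open hemisphere if it is the open hemisphere centred at some point. -/
def IsOpenHemisphere {n : ℕ} (H : Set (Sph n)) : Prop :=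
  ∃ v : Sph n, H = openHemisphere v

/-- `V` is `m`-tame: every non-empty subset of `V` with at most `m` points is contained in some
open hemisphere. -/
def IsTame {n : ℕ} (m : ℕ) (V : Set (Sph n)) : Prop :=
  ∀ F : Finset (Sph n), F.Nonempty → F.card ≤ m → (F : Set (Sph n)) ⊆ V →
    ∃ H : Set (Sph n), IsOpenHemisphere H ∧ (F : Set (Sph n)) ⊆ H

/-- The set of connected components of a subset `U` of a topological space. -/
def componentsOf {X : Type*} [TopologicalSpace X] (U : Set X) : Set (Set X) :=
  {C | ∃ x ∈ U, C = connectedComponentIn U x}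

/-- `U ⊆ S^{n-1}` is weakly maxtame: it is open and `n`-tame, has finitely many components, and is
maximal (for inclusion) amongst the open `n`-tame sets having at most as many components as `U`. -/
def IsWeaklyMaxtame {n : ℕ} (U : Set (Sph n)) : Prop :=
  IsOpen U ∧ IsTame n U ∧ (componentsOf U).Finite ∧
    ∀ V : Set (Sph n), IsOpen V → IsTame n V →
      (componentsOf V).encard ≤ (componentsOf U).encard → U ⊆ V → V = U

/-! Replace the components of `U` by the open cones over them in an `n`-dimensional space. A
connectedness argument (`zero_notMem_convexHull_iUnion`) upgrades tameness from `n` points to `n`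
components: any `n` of the cones lie in a common open half-space. Passing to convex hulls preserves
this, so maximality makes every cone convex, and no single cone can be enlarged without breaking the
condition (`isMaximalTameFamily`).

The rest is linear geometry. Each cone is the intersection of finitely many half-spaces that witness
tameness, hence polyhedral (`exists_eq_openPoly`). A facet of a cone, with functional `v`, cannot be
pushed outwards, so a point of it enters a zero-sum relation with the closed cones of a set `S` of
at most `n` members (`exists_facet_relation`). For a relative interior point, this forces every
functional positive on `S` to be a positive multiple of `v`.

The crux is `posOn_or_neg`: any other cone lies in `v > 0`, or its closure minus the origin lies in
`v < 0`. Otherwise its closure has a nonzero point on `v = 0`; this point is inserted into the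
relation, and `exists_posOn_insert` gives a functional positive on `S` and on that cone. It is again
a multiple of `v`, so the cone lies in `v > 0` after all. The dichotomy yields both the
neighbourhoods `N` and the disjointness of closures. -/

/-! ### Open convex cones, polyhedral cones and separation. -/

section ConvexCones

variable {E : Type*} [NormedAddCommGroup E] [InnerProductSpace ℝ E]

/-- An open convex cone, without requiring or excluding the origin. -/
structure IsOpenConvexCone (K : Set E) : Prop where
  isOpen : IsOpen K
  convex : Convex ℝ K
  nonempty : K.Nonempty
  smul_mem : ∀ t : ℝ, 0 < t → ∀ x ∈ K, t • x ∈ K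

/-- The functional `⟪w, ·⟫` is positive on `K`. -/
def PosOn (w : E) (K : Set E) : Prop := ∀ x ∈ K, 0 < inner ℝ w x

/-- The open polyhedral cone cut out by the functionals in `W`. -/
def openPoly (W : Finset E) : Set E := {x | ∀ w ∈ W, 0 < inner ℝ w x}

/-- The closed polyhedral cone cut out by the functionals in `W`. -/
def closedPoly (W : Finset E) : Set E := {x | ∀ w ∈ W, 0 ≤ inner ℝ w x}

theorem isClosed_closedPoly (W : Finset E) : IsClosed (closedPoly W) := by
  have : closedPoly W = ⋂ w ∈ W, {x : E | 0 ≤ inner ℝ w x} := by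
    ext x; simp [closedPoly]
  rw [this]
  exact isClosed_biInter fun w _ => isClosed_le continuous_const (by fun_prop)

theorem openPoly_subset_closedPoly (W : Finset E) : openPoly W ⊆ closedPoly W :=
  fun _ hx w hw => (hx w hw).le

theorem closedPoly_add_mem {W : Finset E} {x y : E} (hx : x ∈ closedPoly W)
    (hy : y ∈ closedPoly W) : x + y ∈ closedPoly W := fun w hw => by
  rw [inner_add_right]; exact add_nonneg (hx w hw) (hy w hw)

theorem closedPoly_smul_mem {W : Finset E} {x : E} {t : ℝ} (ht : 0 ≤ t)
    (hx : x ∈ closedPoly W) : t • x ∈ closedPoly W := fun w hw => by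
  rw [inner_smul_right]; exact mul_nonneg ht (hx w hw)

theorem isOpenConvexCone_openPoly {W : Finset E} (h : (openPoly W).Nonempty) :
    IsOpenConvexCone (openPoly W) where
  isOpen := by
    have : openPoly W = ⋂ w ∈ W, {x : E | 0 < inner ℝ w x} := by
      ext x; simp [openPoly]
    rw [this]
    exact isOpen_biInter_finset fun w _ => isOpen_lt continuous_const (by fun_prop)
  convex := by
    intro x hx y hy a b ha hb hab w hw
    rw [inner_add_right, inner_smul_right, inner_smul_right]
    have h1 := hx w hw
    have h2 := hy w hw
    rcases ha.eq_or_lt with rfl | ha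
    · have : b = 1 := by linarith
      subst this; linarith
    · have := mul_pos ha h1
      have := mul_nonneg hb h2.le
      linarith
  nonempty := h
  smul_mem := fun t ht x hx w hw => by
    rw [inner_smul_right]; exact mul_pos ht (hx w hw)

/-- A negative value at `x` could be cancelled exactly by adding a multiple of an interior point
`q`, yet the sum lies in the open cone. -/
theorem PosOn.nonneg_of_mem_closedPoly {w : E} {W : Finset E} (h : PosOn w (openPoly W))
    (hne : (openPoly W).Nonempty) {x : E} (hx : x ∈ closedPoly W) : 0 ≤ inner ℝ w x := by
  obtain ⟨q, hq⟩ := hne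
  by_contra! hneg
  have hq' := h q hq
  set t : ℝ := -(inner ℝ w x) / inner ℝ w q with ht
  have ht0 : 0 < t := div_pos (by linarith) hq'
  have := h (x + t • q) fun v hv => by
    rw [inner_add_right, inner_smul_right]
    exact add_pos_of_nonneg_of_pos (hx v hv) (mul_pos ht0 (hq v hv))
  rw [inner_add_right, inner_smul_right, ht, div_mul_cancel₀ _ hq'.ne'] at this
  linarith

theorem posOn_of_nonneg {K : Set E} (hK : IsOpen K) {w : E} (hw : w ≠ 0)
    (h : ∀ x ∈ K, 0 ≤ inner ℝ w x) : PosOn w K := by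
  intro x hx
  have hc : Filter.Tendsto (fun t : ℝ => x - t • w) (𝓝[>] 0) (𝓝 x) := by
    have : Continuous fun t : ℝ => x - t • w := by fun_prop
    have h2 := this.tendsto 0
    simp only [zero_smul, sub_zero] at h2
    exact h2.mono_left nhdsWithin_le_nhds
  obtain ⟨t, ht, ht0⟩ :=
    ((hc.eventually (hK.mem_nhds hx)).and (eventually_mem_nhdsWithin)).exists
  have h1 := h _ ht
  rw [inner_sub_right, inner_smul_right] at h1
  have h2 : 0 < inner ℝ w w := real_inner_self_pos.2 hw
  have := mul_pos (Set.mem_Ioi.1 ht0) h2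
  linarith

variable [FiniteDimensional ℝ E]

theorem exists_posOn_of_convex {M : Set E} (hM : IsOpen M) (hc : Convex ℝ M)
    (h0 : (0 : E) ∉ M) : ∃ w : E, PosOn w M := by
  obtain ⟨f, hf⟩ := geometric_hahn_banach_open_point hc hM h0
  refine ⟨-(InnerProductSpace.toDual ℝ E).symm f, fun x hx => ?_⟩
  rw [inner_neg_left, InnerProductSpace.toDual_symm_apply]
  have := hf x hx
  rw [map_zero] at this
  linarith

/-- A form of Gordan's alternative. The sum of the cones is open and convex; if it misses the
origin, a functional positive on it is nonnegative on each summand, since one summand can be scaled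
to dominate the others. -/
theorem exists_posOn_or_sum_eq_zero {ι : Type*} [DecidableEq ι] {K : ι → Set E} {S : Finset ι}
    (hS : S.Nonempty)
    (hK : ∀ s ∈ S, IsOpenConvexCone (K s)) :
    (∃ w : E, ∀ s ∈ S, PosOn w (K s)) ∨
      ∃ ξ : ι → E, (∀ s ∈ S, ξ s ∈ K s) ∧ ∑ s ∈ S, ξ s = 0 := by
  by_cases h0 : ∃ ξ : ι → E, (∀ s ∈ S, ξ s ∈ K s) ∧ ∑ s ∈ S, ξ s = 0
  · exact Or.inr h0
  left
  set M : Set E := {x | ∃ ξ : ι → E, (∀ s ∈ S, ξ s ∈ K s) ∧ ∑ s ∈ S, ξ s = x} with hM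
  have hex : ∀ s, ∃ x, s ∈ S → x ∈ K s := fun s => by
    by_cases hs : s ∈ S
    · obtain ⟨x, hx⟩ := (hK s hs).nonempty
      exact ⟨x, fun _ => hx⟩
    · exact ⟨0, fun h => absurd h hs⟩
  choose q hq using hex
  have hMo : IsOpen M := by
    rw [Metric.isOpen_iff]
    rintro x ⟨ξ, hξ, rfl⟩
    obtain ⟨s, hs⟩ := hS
    obtain ⟨ε, hε, hb⟩ := Metric.isOpen_iff.1 (hK s hs).isOpen _ (hξ s hs)
    refine ⟨ε, hε, fun y hy => ?_⟩
    refine ⟨Function.update ξ s (ξ s + (y - ∑ r ∈ S, ξ r)), fun r hr => ?_, ?_⟩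
    · rcases eq_or_ne r s with rfl | hrs
      · rw [Function.update_self]
        apply hb
        simpa [dist_eq_norm] using hy
      · rw [Function.update_of_ne hrs]; exact hξ r hr
    · rw [Finset.sum_update_of_mem hs, ← Finset.erase_eq]
      rw [add_right_comm, Finset.add_sum_erase _ _ hs]; abel
  have hMc : Convex ℝ M := by
    rintro _ ⟨ξ, hξ, rfl⟩ _ ⟨η, hη, rfl⟩ a b ha hb hab
    refine ⟨fun s => a • ξ s + b • η s,
      fun s hs => (hK s hs).convex (hξ s hs) (hη s hs) ha hb hab, ?_⟩
    rw [Finset.sum_add_distrib, Finset.smul_sum, Finset.smul_sum]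
  obtain ⟨w, hw⟩ := exists_posOn_of_convex hMo hMc h0
  have hw0 : w ≠ 0 := by
    rintro rfl
    have := hw _ ⟨q, fun s hs => hq s hs, rfl⟩
    simp at this
  refine ⟨w, fun s hs => posOn_of_nonneg (hK s hs).isOpen hw0 fun x hx => ?_⟩
  by_contra! hneg
  set c : ℝ := ∑ r ∈ S.erase s, inner ℝ w (q r) with hc
  -- Large enough for `T • x` to outweigh the contribution `c` of the other summands.
  set T : ℝ := |c| / (-(inner ℝ w x)) + 1 with hT
  have hT0 : 0 < T := by
    have : 0 ≤ |c| / (-(inner ℝ w x)) := div_nonneg (abs_nonneg _) (by linarith)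
    linarith
  have hmem : ∑ r ∈ S, Function.update q s (T • x) r ∈ M := by
    refine ⟨_, fun r hr => ?_, rfl⟩
    rcases eq_or_ne r s with rfl | hrs
    · rw [Function.update_self]; exact (hK r hr).smul_mem T hT0 x hx
    · rw [Function.update_of_ne hrs]; exact hq r hr
  have h1 := hw _ hmem
  rw [Finset.sum_update_of_mem hs, ← Finset.erase_eq, inner_add_right, inner_smul_right,
    inner_sum, ← hc, hT] at h1
  have h2 : |c| / (-(inner ℝ w x)) * inner ℝ w x = -|c| := by
    field_simp [hneg.ne]
  have := le_abs_self c
  nlinarith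

end ConvexCones

/-! ### Linear images of polyhedral cones are closed. -/

section PolyhedralImage

variable {W F : Type*} [NormedAddCommGroup W] [NormedSpace ℝ W] [FiniteDimensional ℝ W]
  [NormedAddCommGroup F] [NormedSpace ℝ F]

/-- A continuous linear map which kills no nonzero point of a closed cone maps it to a closed
set. -/
theorem isClosed_image_of_injOn_cone (A : W →L[ℝ] F) {P : Set W} (hP : IsClosed P)
    (hsmul : ∀ t : ℝ, 0 ≤ t → ∀ x ∈ P, t • x ∈ P) (hker : ∀ x ∈ P, A x = 0 → x = 0) :
    IsClosed (A '' P) := by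
  obtain ⟨c, hc, hbound⟩ : ∃ c : ℝ, 0 < c ∧ ∀ x ∈ P, c * ‖x‖ ≤ ‖A x‖ := by
    have hcomp : IsCompact (P ∩ Metric.sphere 0 1) :=
      (isCompact_sphere (0 : W) 1).inter_left hP
    have key : ∀ c : ℝ, (∀ u ∈ P ∩ Metric.sphere 0 1, c ≤ ‖A u‖) →
        ∀ x ∈ P, c * ‖x‖ ≤ ‖A x‖ := by
      intro c h x hx
      rcases eq_or_ne x 0 with rfl | hx0
      · simp
      have hn : 0 < ‖x‖ := norm_pos_iff.2 hx0
      have := h (‖x‖⁻¹ • x) ⟨hsmul _ (inv_nonneg.2 hn.le) x hx, by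
        simp [norm_smul, hn.ne']⟩
      rw [map_smul, norm_smul, norm_inv, norm_norm, ← div_eq_inv_mul, le_div_iff₀ hn] at this
      exact this
    rcases (P ∩ Metric.sphere 0 1).eq_empty_or_nonempty with he | hne
    · exact ⟨1, one_pos, key 1 (by simp [he])⟩
    · obtain ⟨u, hu, hmin⟩ := hcomp.exists_isMinOn hne (A.continuous.norm.continuousOn)
      refine ⟨‖A u‖, norm_pos_iff.2 fun h0 => ?_, key _ fun x hx => hmin hx⟩
      have h1 := hker u hu.1 h0
      have h2 := hu.2
      simp [h1] at h2
  refine isClosed_of_closure_subset fun e he => ?_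
  have h1 : e ∈ closure (Metric.ball e 1 ∩ A '' P) :=
    Metric.isOpen_ball.inter_closure ⟨Metric.mem_ball_self one_pos, he⟩
  have hcomp : IsCompact (A '' (P ∩ Metric.closedBall 0 ((‖e‖ + 1) / c))) :=
    ((isCompact_closedBall (0 : W) _).inter_left hP).image A.continuous
  have hsub : Metric.ball e 1 ∩ A '' P ⊆ A '' (P ∩ Metric.closedBall 0 ((‖e‖ + 1) / c)) := by
    rintro _ ⟨hb, x, hx, rfl⟩
    refine ⟨x, ⟨hx, ?_⟩, rfl⟩
    rw [mem_closedBall_zero_iff, le_div_iff₀ hc, mul_comm]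
    refine (hbound x hx).trans ?_
    have h2 : ‖A x - e‖ < 1 := by simpa [dist_eq_norm] using hb
    have h3 := norm_le_norm_add_norm_sub' (A x) e
    linarith
  have := closure_minimal hsub hcomp.isClosed h1
  exact Set.image_mono Set.inter_subset_left this

/-- Induction on the dimension of `V`. Given a nonzero `u` of the cone killed by `A`, points can be
slid along `u` without changing their image, which reduces to proper subspaces of `V`. If there is
no such `u`, compactness of the unit sphere suffices. -/
theorem isClosed_image_polyhedral_aux (A : W →L[ℝ] F) (Φ : Finset (W →L[ℝ] ℝ)) (d : ℕ) :
    ∀ V : Submodule ℝ W, Module.finrank ℝ V = d →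
      IsClosed (A '' {y | y ∈ V ∧ ∀ f ∈ Φ, 0 ≤ f y}) := by
  induction d using Nat.strong_induction_on with
  | _ d ih =>
  intro V hV
  have hdrop : ∀ u ∈ V, ∀ g : W →L[ℝ] ℝ, g u ≠ 0 →
      IsClosed (A '' {y | y ∈ V ⊓ LinearMap.ker (g : W →ₗ[ℝ] ℝ) ∧ ∀ f ∈ Φ, 0 ≤ f y}) := by
    intro u hu g hg
    refine ih _ ?_ _ rfl
    rw [← hV]
    refine Submodule.finrank_lt_finrank_of_lt (lt_of_le_of_ne inf_le_left fun h => hg ?_)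
    rw [← h] at hu
    exact hu.2
  by_cases hu : ∃ u ∈ V, u ≠ 0 ∧ A u = 0 ∧ ∀ f ∈ Φ, 0 ≤ f u
  · obtain ⟨u, huV, hu0, hAu, hfu⟩ := hu
    by_cases hf : ∃ f ∈ Φ, 0 < f u
    · obtain ⟨f₀, hf₀, hf₀u⟩ := hf
      have hfin : {f | f ∈ Φ ∧ 0 < f u}.Finite := Φ.finite_toSet.subset fun f hf => hf.1
      have : A '' {y | y ∈ V ∧ ∀ f ∈ Φ, 0 ≤ f y} = ⋃ g ∈ {f | f ∈ Φ ∧ 0 < f u},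
          A '' {y | y ∈ V ⊓ LinearMap.ker (g : W →ₗ[ℝ] ℝ) ∧ ∀ f ∈ Φ, 0 ≤ f y} := by
        apply Set.Subset.antisymm
        · rintro _ ⟨y, ⟨hyV, hy⟩, rfl⟩
          -- `g` is the first constraint to become tight when `y` moves in the direction `-u`.
          obtain ⟨g, hg, hmin⟩ := hfin.toFinset.exists_min_image (fun f => f y / f u)
            ⟨f₀, by simp [hf₀, hf₀u]⟩
          simp only [Set.Finite.mem_toFinset, Set.mem_ofPred_eq] at hg hmin
          refine Set.mem_biUnion hg ⟨y - (g y / g u) • u, ⟨⟨?_, ?_⟩, fun f hf => ?_⟩, ?_⟩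
          · exact V.sub_mem hyV (V.smul_mem _ huV)
          · have := hg.2.ne'
            change g (y - (g y / g u) • u) = 0
            rw [map_sub, map_smul, smul_eq_mul, div_mul_cancel₀ _ this, sub_self]
          · rw [map_sub, map_smul, smul_eq_mul]
            rcases (hfu f hf).eq_or_lt with h0 | h0
            · rw [← h0]; simpa using hy f hf
            · have := hmin f ⟨hf, h0⟩
              rw [le_div_iff₀ h0] at this
              linarith
          · rw [map_sub, map_smul, hAu, smul_zero, sub_zero]
        · refine Set.iUnion₂_subset fun g _ => Set.image_mono fun y hy => ⟨hy.1.1, hy.2⟩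
      rw [this]
      exact hfin.isClosed_biUnion fun g hg => hdrop u huV g hg.2.ne'
    · push Not at hf
      obtain ⟨g, hg⟩ : ∃ g : W →L[ℝ] ℝ, g u ≠ 0 := by
        obtain ⟨g, -, hg⟩ := exists_dual_vector ℝ u (norm_ne_zero_iff.2 hu0)
        exact ⟨g, by rw [hg]; simpa using hu0⟩
      have : A '' {y | y ∈ V ∧ ∀ f ∈ Φ, 0 ≤ f y} =
          A '' {y | y ∈ V ⊓ LinearMap.ker (g : W →ₗ[ℝ] ℝ) ∧ ∀ f ∈ Φ, 0 ≤ f y} := by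
        apply Set.Subset.antisymm
        · rintro _ ⟨y, ⟨hyV, hy⟩, rfl⟩
          refine ⟨y - (g y / g u) • u, ⟨⟨?_, ?_⟩, fun f hf' => ?_⟩, ?_⟩
          · exact V.sub_mem hyV (V.smul_mem _ huV)
          · change g (y - (g y / g u) • u) = 0
            rw [map_sub, map_smul, smul_eq_mul, div_mul_cancel₀ _ hg, sub_self]
          · rw [map_sub, map_smul, le_antisymm (hf f hf') (hfu f hf')]
            simpa using hy f hf'
          · rw [map_sub, map_smul, hAu, smul_zero, sub_zero]
        · exact Set.image_mono fun y hy => ⟨hy.1.1, hy.2⟩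
      rw [this]
      exact hdrop u huV g hg
  · push Not at hu
    apply isClosed_image_of_injOn_cone
    · have : {y | y ∈ V ∧ ∀ f ∈ Φ, 0 ≤ f y} = (V : Set W) ∩ ⋂ f ∈ Φ, {y | 0 ≤ f y} := by
        ext y; simp
      rw [this]
      exact V.closed_of_finiteDimensional.inter
        (isClosed_biInter fun f _ => isClosed_le continuous_const f.continuous)
    · rintro t ht x ⟨hxV, hx⟩
      refine ⟨V.smul_mem _ hxV, fun f hf => ?_⟩
      rw [map_smul]
      exact mul_nonneg ht (hx f hf)
    · rintro x ⟨hxV, hx⟩ hA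
      by_contra hx0
      obtain ⟨f, hf, hneg⟩ := hu x hxV hx0 hA
      exact absurd (hx f hf) (not_le.2 hneg)

/-- A linear image of a polyhedral cone is closed. -/
theorem isClosed_image_polyhedral (A : W →L[ℝ] F) (Φ : Finset (W →L[ℝ] ℝ)) :
    IsClosed (A '' {y | ∀ f ∈ Φ, 0 ≤ f y}) := by
  simpa using isClosed_image_polyhedral_aux A Φ _ ⊤ rfl

end PolyhedralImage

/-! ### Normalising linear relations. -/

section Relations

/-- Makes the coefficients `1 - t * c s` nonnegative on `A` with one of them zero, so that
subtracting a relation removes a term, as in Carathéodory's theorem. -/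
theorem exists_scale_to_one {ι : Type*} {A : Finset ι} {c : ι → ℝ} (h : ∃ s ∈ A, 0 < c s) :
    ∃ t : ℝ, 0 < t ∧ ∃ s₀ ∈ A, t * c s₀ = 1 ∧ ∀ s ∈ A, t * c s ≤ 1 := by
  obtain ⟨s₁, hs₁, hpos⟩ := h
  obtain ⟨s₀, hs₀, hmax⟩ := A.exists_max_image c ⟨s₁, hs₁⟩
  have h0 : 0 < c s₀ := hpos.trans_le (hmax s₁ hs₁)
  refine ⟨(c s₀)⁻¹, inv_pos.2 h0, s₀, hs₀, inv_mul_cancel₀ h0.ne', fun s hs => ?_⟩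
  rw [inv_mul_le_iff₀ h0, mul_one]
  exact hmax s hs

theorem exists_relation_of_finrank_lt_card {ι E : Type*} [AddCommGroup E] [Module ℝ E]
    [FiniteDimensional ℝ E] (A : Finset ι) (u : ι → E) (h : Module.finrank ℝ E < A.card) :
    ∃ c : ι → ℝ, ∑ s ∈ A, c s • u s = 0 ∧ ∃ s ∈ A, c s ≠ 0 := by
  by_contra! hcon
  have hli : LinearIndepOn ℝ u (A : Set ι) := linearIndepOn_finset_iff.2 hcon
  have := LinearIndependent.fintype_card_le_finrank hli
  simp only [Finset.coe_sort_coe, Fintype.card_coe] at this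
  omega

end Relations

/-! ### Zero-sum relations between polyhedral cones, and facets. -/

section Core

variable {E : Type*} [NormedAddCommGroup E] [InnerProductSpace ℝ E] [FiniteDimensional ℝ E]
  {ι : Type*}

theorem isClosed_sum_closedPoly [Fintype ι] (W : ι → Finset E) (S : Finset ι) :
    IsClosed {x | ∃ y : ι → E, (∀ s ∈ S, y s ∈ closedPoly (W s)) ∧ ∑ s ∈ S, y s = x} := by
  classical
  let A : (ι → E) →L[ℝ] E := ∑ s ∈ S, ContinuousLinearMap.proj s
  let Φ : Finset ((ι → E) →L[ℝ] ℝ) := S.biUnion fun s => (W s).image fun w =>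
    (innerSL ℝ w).comp (ContinuousLinearMap.proj s)
  convert isClosed_image_polyhedral A Φ using 1
  ext x
  have hΦ : ∀ y : ι → E, (∀ f ∈ Φ, 0 ≤ f y) ↔ ∀ s ∈ S, y s ∈ closedPoly (W s) := fun y => by
    constructor
    · intro h s hs w hw
      exact h _ (Finset.mem_biUnion.2 ⟨s, hs, Finset.mem_image_of_mem _ hw⟩)
    · intro h f hf
      obtain ⟨s, hs, hf⟩ := Finset.mem_biUnion.1 hf
      obtain ⟨w, hw, rfl⟩ := Finset.mem_image.1 hf
      exact h s hs w hw
  simp [A, hΦ]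

omit [FiniteDimensional ℝ E] in
/-- In a relation of shortest length extending a fixed vector, the other vectors are linearly
independent. -/
theorem exists_independent_relation [DecidableEq ι] {W : ι → Finset E} {S : Finset ι}
    {z : E} (y : ι → E) (hy : ∀ s ∈ S, y s ∈ closedPoly (W s)) (hsum : z + ∑ s ∈ S, y s = 0) :
    ∃ T ⊆ S, ∃ y' : ι → E, (∀ s ∈ T, y' s ∈ closedPoly (W s)) ∧ z + ∑ s ∈ T, y' s = 0 ∧
      ∀ c : ι → ℝ, ∑ s ∈ T, c s • y' s = 0 → ∀ s ∈ T, c s = 0 := by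
  induction S using Finset.strongInduction generalizing y with
  | H S ih =>
  by_cases hind : ∀ c : ι → ℝ, ∑ s ∈ S, c s • y s = 0 → ∀ s ∈ S, c s = 0
  · exact ⟨S, subset_rfl, y, hy, hsum, hind⟩
  push Not at hind
  obtain ⟨c, hc, hpos⟩ : ∃ c : ι → ℝ, ∑ s ∈ S, c s • y s = 0 ∧ ∃ s ∈ S, 0 < c s := by
    obtain ⟨c, hc, s, hs, hs0⟩ := hind
    rcases hs0.lt_or_gt with h | h
    · exact ⟨fun s => -c s, by simp [hc], s, hs, by simpa using h⟩
    · exact ⟨c, hc, s, hs, h⟩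
  obtain ⟨t, ht, s₀, hs₀, hone, hle⟩ := exists_scale_to_one hpos
  obtain ⟨T, hT, y', h⟩ := ih (S.erase s₀) (Finset.erase_ssubset hs₀)
    (fun s => (1 - t * c s) • y s)
    (fun s hs => closedPoly_smul_mem (by
      have := hle s (Finset.mem_of_mem_erase hs); linarith) (hy s (Finset.mem_of_mem_erase hs)))
    (by
      have h1 : ∑ s ∈ S, (1 - t * c s) • y s = ∑ s ∈ S, y s := by
        simp only [sub_smul, one_smul, Finset.sum_sub_distrib, mul_smul, ← Finset.smul_sum, hc,
          smul_zero, sub_zero]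
      rw [← Finset.add_sum_erase _ _ hs₀, hone] at h1
      simp only [sub_self, zero_smul, zero_add] at h1
      rw [h1, hsum])
  exact ⟨T, hT.trans (Finset.erase_subset _ _), y', h⟩

/-- Only `n + 1` cones need an argument. If they had no common half-space, interior points `ξ s`
would sum to zero. Combining this relation with the given one eliminates an index `s₀` outside the
support `T` of a shortest relation. A functional positive on the remaining `n` cones and nonnegative
at `z` then contradicts the result; `v` serves when `s₀ = l`. -/
theorem exists_posOn_insert [DecidableEq ι] {W : ι → Finset E} {S : Finset ι} {l : ι}
    (hne : ∀ s ∈ insert l S, (openPoly (W s)).Nonempty)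
    (hlS : l ∉ S) (hcard : S.card ≤ Module.finrank ℝ E)
    (htame : ∀ T ⊆ insert l S, T.card ≤ Module.finrank ℝ E →
      ∃ w : E, ∀ s ∈ T, PosOn w (openPoly (W s)))
    {v z : E} (hv : ∀ s ∈ S, PosOn v (openPoly (W s))) (hvz : 0 ≤ inner ℝ v z)
    (hz : z ∈ closedPoly (W l)) (hz0 : z ≠ 0) {y : ι → E}
    (hy : ∀ s ∈ S, y s ∈ closedPoly (W s)) (hsum : z + ∑ s ∈ S, y s = 0) :
    ∃ w : E, ∀ s ∈ insert l S, PosOn w (openPoly (W s)) := by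
  set A := insert l S with hA
  have hcardA : A.card = S.card + 1 := Finset.card_insert_of_notMem hlS
  by_cases hsmall : A.card ≤ Module.finrank ℝ E
  · exact htame A subset_rfl hsmall
  refine (exists_posOn_or_sum_eq_zero ⟨l, Finset.mem_insert_self _ _⟩
    fun s hs => isOpenConvexCone_openPoly (hne s hs)).resolve_right ?_
  rintro ⟨ξ, hξ, hξsum⟩
  obtain ⟨T, hTS, y, hy, hsum, hind⟩ := exists_independent_relation y hy hsum
  have hTA : T ⊆ A := hTS.trans (Finset.subset_insert _ _)
  have hTne : T.Nonempty := by
    rw [Finset.nonempty_iff_ne_empty]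
    rintro rfl
    simp [hz0] at hsum
  obtain ⟨c, hc, hpos⟩ : ∃ c : ι → ℝ, ∑ s ∈ T, c s • y s + ∑ s ∈ A \ T, c s • ξ s = 0 ∧
      ∃ s ∈ A \ T, 0 < c s := by
    obtain ⟨c, hc, s, hs, hs0⟩ := exists_relation_of_finrank_lt_card A
      (fun s => if s ∈ T then y s else ξ s) (not_le.1 hsmall)
    have hc' : ∑ s ∈ T, c s • y s + ∑ s ∈ A \ T, c s • ξ s = 0 := by
      rw [← hc, ← Finset.sum_sdiff hTA, add_comm]
      congr 1
      · exact Finset.sum_congr rfl fun s hs => by rw [if_neg (Finset.mem_sdiff.1 hs).2]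
      · exact Finset.sum_congr rfl fun s hs => by rw [if_pos hs]
    -- The vectors `y s` with `s ∈ T` are independent, so the dependence must involve some `ξ s`.
    obtain ⟨s, hs, hs0⟩ : ∃ s ∈ A \ T, c s ≠ 0 := by
      by_contra! hzero
      have h2 : ∑ s ∈ A \ T, c s • ξ s = 0 :=
        Finset.sum_eq_zero fun s hs => by rw [hzero s hs, zero_smul]
      rw [h2, add_zero] at hc'
      by_cases hsT : s ∈ T
      · exact hs0 (hind c hc' s hsT)
      · exact hs0 (hzero s (Finset.mem_sdiff.2 ⟨hs, hsT⟩))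
    rcases hs0.lt_or_gt with h | h
    · refine ⟨fun s => -c s, ?_, s, hs, by simpa using h⟩
      simp only [neg_smul, Finset.sum_neg_distrib, ← neg_add, hc', neg_zero]
    · exact ⟨c, hc', s, hs, h⟩
  obtain ⟨t, ht, s₀, hs₀, hone, hle⟩ := exists_scale_to_one hpos
  have hs₀A := (Finset.mem_sdiff.1 hs₀).1
  have hs₀T := (Finset.mem_sdiff.1 hs₀).2
  obtain ⟨w, hw, hwz⟩ : ∃ w : E, (∀ s ∈ A, s ≠ s₀ → PosOn w (openPoly (W s))) ∧
      0 ≤ inner ℝ w z := by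
    rcases eq_or_ne s₀ l with rfl | hne'
    · exact ⟨v, fun s hs hss => hv s ((Finset.mem_insert.1 hs).resolve_left hss), hvz⟩
    · obtain ⟨w, hw⟩ := htame (A.erase s₀) (Finset.erase_subset _ _) (by
        rw [Finset.card_erase_of_mem hs₀A]; omega)
      exact ⟨w, fun s hs hss => hw s (Finset.mem_erase.2 ⟨hss, hs⟩),
        (hw l (Finset.mem_erase.2 ⟨hne'.symm, Finset.mem_insert_self _ _⟩)).nonneg_of_mem_closedPoly
          (hne l (Finset.mem_insert_self _ _)) hz⟩
  -- Adding `M` times the relation for `z` makes the coefficients of the `y s` nonnegative. The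
  -- terms `ξ s` with `s ∈ T` remain and give strict positivity.
  set M : ℝ := ∑ s ∈ T, |t * c s| with hM
  have hM0 : 0 ≤ M := Finset.sum_nonneg fun s _ => abs_nonneg _
  have hrel : ∑ s ∈ T, ξ s + ∑ s ∈ A \ T, (1 - t * c s) • ξ s +
      ∑ s ∈ T, (M - t * c s) • y s + M • z = 0 := by
    simp only [sub_smul, one_smul, Finset.sum_sub_distrib, mul_smul, ← Finset.smul_sum]
    have h1 : ∑ s ∈ T, ξ s + ∑ s ∈ A \ T, ξ s = 0 := by
      rw [add_comm, Finset.sum_sdiff hTA, hξsum]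
    calc _ = (∑ s ∈ T, ξ s + ∑ s ∈ A \ T, ξ s) + M • (z + ∑ s ∈ T, y s) -
          t • (∑ s ∈ T, c s • y s + ∑ s ∈ A \ T, c s • ξ s) := by
          simp only [smul_add]; abel
      _ = 0 := by rw [h1, hsum, hc]; simp
  have h0 := congrArg (inner ℝ w) hrel
  simp only [inner_add_right, inner_sum, inner_smul_right, inner_zero_right] at h0
  have hTs₀ : ∀ s ∈ T, s ≠ s₀ := fun s hs h => hs₀T (h ▸ hs)
  have p1 : 0 < ∑ s ∈ T, inner ℝ w (ξ s) :=
    Finset.sum_pos (fun s hs => hw s (hTA hs) (hTs₀ s hs) _ (hξ s (hTA hs))) hTne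
  have p2 : 0 ≤ ∑ s ∈ A \ T, (1 - t * c s) * inner ℝ w (ξ s) :=
    Finset.sum_nonneg fun s hs => by
      rcases eq_or_ne s s₀ with rfl | hss
      · rw [hone]; simp
      · have hsA := (Finset.mem_sdiff.1 hs).1
        exact mul_nonneg (by linarith [hle s hs]) (hw s hsA hss _ (hξ s hsA)).le
  have p3 : 0 ≤ ∑ s ∈ T, (M - t * c s) * inner ℝ w (y s) :=
    Finset.sum_nonneg fun s hs => by
      refine mul_nonneg ?_ ((hw s (hTA hs) (hTs₀ s hs)).nonneg_of_mem_closedPoly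
        (hne s (hTA hs)) (hy s hs))
      have := Finset.single_le_sum (f := fun s => |t * c s|) (fun s _ => abs_nonneg _) hs
      have := le_abs_self (t * c s)
      linarith
  have p4 : 0 ≤ M * inner ℝ w z := mul_nonneg hM0 hwz
  linarith

omit [FiniteDimensional ℝ E] in
/-- A finite system of strict inequalities can be made irredundant: each facet hyperplane has a
point on which the remaining functionals are positive. -/
theorem exists_irredundant [DecidableEq E] (W₀ : Finset E) (hne : (openPoly W₀).Nonempty) :
    ∃ W ⊆ W₀, openPoly W = openPoly W₀ ∧
      ∀ v ∈ W, ∃ x, inner ℝ v x = 0 ∧ ∀ w ∈ W, w ≠ v → 0 < inner ℝ w x := by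
  induction W₀ using Finset.strongInduction with
  | H W₀ ih =>
  by_cases hred : ∃ v ∈ W₀, openPoly (W₀.erase v) = openPoly W₀
  · obtain ⟨v, hv, h⟩ := hred
    obtain ⟨W, hW, hWeq, hirr⟩ := ih (W₀.erase v) (Finset.erase_ssubset hv) (h ▸ hne)
    exact ⟨W, hW.trans (Finset.erase_subset _ _), hWeq.trans h, hirr⟩
  push Not at hred
  refine ⟨W₀, subset_rfl, rfl, fun v hv => ?_⟩
  obtain ⟨p, hp, hpv⟩ : ∃ p ∈ openPoly (W₀.erase v), inner ℝ v p ≤ 0 := by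
    by_contra! hcon
    refine hred v hv (Set.Subset.antisymm (fun p hp w hw => ?_)
      fun p hp w hw => hp w (Finset.mem_of_mem_erase hw))
    rcases eq_or_ne w v with rfl | hwv
    · exact hcon p hp
    · exact hp w (Finset.mem_erase.2 ⟨hwv, hw⟩)
  obtain ⟨q, hq⟩ := hne
  -- A nonnegative combination of `p` and `q`, on opposite sides of the hyperplane of `v`, weighted
  -- to lie on it.
  refine ⟨inner ℝ v q • p - inner ℝ v p • q, ?_, fun w hw hwv => ?_⟩
  · rw [inner_sub_right, inner_smul_right, inner_smul_right]; ring
  · rw [inner_sub_right, inner_smul_right, inner_smul_right]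
    have h1 := mul_pos (hq v hv) (hp w (Finset.mem_erase.2 ⟨hwv, hw⟩))
    have h2 := mul_nonneg (neg_nonneg.2 hpv) (hq w hw).le
    linarith

omit [FiniteDimensional ℝ E] in
theorem exists_add_smul_mem_closedPoly {W : Finset E} {v x u : E}
    (hx : inner ℝ v x = 0) (hxW : ∀ w ∈ W, w ≠ v → 0 < inner ℝ w x) (hu : inner ℝ v u = 0) :
    ∃ δ : ℝ, 0 < δ ∧ x + δ • u ∈ closedPoly W := by
  have h : ∀ᶠ δ in 𝓝[>] (0 : ℝ), ∀ w ∈ W, 0 ≤ inner ℝ w (x + δ • u) := by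
    rw [Filter.eventually_all_finset]
    intro w hw
    rcases eq_or_ne w v with rfl | hwv
    · refine Filter.Eventually.of_forall fun δ => ?_
      rw [inner_add_right, inner_smul_right, hx, hu]; simp
    · have hc : Continuous fun δ : ℝ => inner ℝ w (x + δ • u) := by fun_prop
      have := hc.tendsto 0
      simp only [zero_smul, add_zero] at this
      exact ((this.mono_left nhdsWithin_le_nhds).eventually_const_lt (hxW w hw hwv)).mono
        fun _ h => h.le
  obtain ⟨δ, h1, h2⟩ := (h.and eventually_mem_nhdsWithin).exists
  exact ⟨δ, h2, h1⟩

omit [FiniteDimensional ℝ E] in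
/-- A functional which is nonnegative on a polyhedral cone and not positive at an interior point
of a facet is proportional to the functional defining the facet. -/
theorem inner_mul_eq_of_facet {W : Finset E} {v w x : E}
    (hx : inner ℝ v x = 0) (hxW : ∀ w ∈ W, w ≠ v → 0 < inner ℝ w x)
    (hw : ∀ y ∈ closedPoly W, 0 ≤ inner ℝ w y) (hwx : inner ℝ w x ≤ 0) (q y : E) :
    inner ℝ v q * inner ℝ w y = inner ℝ v y * inner ℝ w q := by
  -- `x` can move a little in every direction of the hyperplane. Applied to opposite vectors, this
  -- makes `w` vanish on the hyperplane.
  have key : ∀ u, inner ℝ v u = 0 → 0 ≤ inner ℝ w u := by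
    intro u hu
    obtain ⟨δ, hδ, hmem⟩ := exists_add_smul_mem_closedPoly hx hxW hu
    have := hw _ hmem
    rw [inner_add_right, inner_smul_right] at this
    exact nonneg_of_mul_nonneg_right (by linarith) hδ
  have h1 := key (inner ℝ v q • y - inner ℝ v y • q) (by
    rw [inner_sub_right, inner_smul_right, inner_smul_right]; ring)
  have h2 := key (inner ℝ v y • q - inner ℝ v q • y) (by
    rw [inner_sub_right, inner_smul_right, inner_smul_right]; ring)
  rw [inner_sub_right, inner_smul_right, inner_smul_right] at h1 h2
  linarith

end Core

/-! ### Maximal families of cones and the facet dichotomy. -/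

section MaximalFamily

variable {E : Type*} [NormedAddCommGroup E] [InnerProductSpace ℝ E] [FiniteDimensional ℝ E]
  {ι : Type*}

/-- A family of open convex cones in an `n`-dimensional space such that any `n` of them lie in a
common open half-space, and none of which can be enlarged. -/
structure IsMaximalTameFamily (K : ι → Set E) : Prop where
  cone : ∀ i, IsOpenConvexCone (K i)
  tame : ∀ S : Finset ι, S.card ≤ Module.finrank ℝ E → ∃ w : E, ∀ s ∈ S, PosOn w (K s)
  maximal : ∀ i (K' : Set E), IsOpenConvexCone K' → K i ⊆ K' →
    (∀ J : Finset ι, i ∉ J → J.card + 1 ≤ Module.finrank ℝ E →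
      ∃ w : E, PosOn w K' ∧ ∀ j ∈ J, PosOn w (K j)) → K' = K i

-- Choose one half-space for each admissible set `J` of other indices. Their intersection contains
-- `K i` and passes the same tests, so maximality gives equality.
omit [FiniteDimensional ℝ E] in
theorem IsMaximalTameFamily.exists_eq_openPoly [Finite ι] {K : ι → Set E}
    (hK : IsMaximalTameFamily K) (i : ι) :
    ∃ W : Finset E, K i = openPoly W ∧
      ∀ v ∈ W, ∃ x, inner ℝ v x = 0 ∧ ∀ w ∈ W, w ≠ v → 0 < inner ℝ w x := by
  classical
  have := Fintype.ofFinite ι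
  have hex : ∀ J : Finset ι, ∃ w : E, i ∉ J → J.card + 1 ≤ Module.finrank ℝ E →
      ∀ s ∈ insert i J, PosOn w (K s) := fun J => by
    by_cases h : i ∉ J ∧ J.card + 1 ≤ Module.finrank ℝ E
    · obtain ⟨w, hw⟩ := hK.tame (insert i J) (by rw [Finset.card_insert_of_notMem h.1]; exact h.2)
      exact ⟨w, fun _ _ => hw⟩
    · exact ⟨0, fun h1 h2 => absurd ⟨h1, h2⟩ h⟩
  choose w hw using hex
  let 𝓙 : Finset (Finset ι) :=
    Finset.univ.filter fun J => i ∉ J ∧ J.card + 1 ≤ Module.finrank ℝ E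
  let W₀ : Finset E := 𝓙.image w
  have hsub : K i ⊆ openPoly W₀ := by
    intro x hx v hv
    obtain ⟨J, hJ, rfl⟩ := Finset.mem_image.1 hv
    have hJ' := (Finset.mem_filter.1 hJ).2
    exact hw J hJ'.1 hJ'.2 i (Finset.mem_insert_self _ _) x hx
  have hne : (openPoly W₀).Nonempty := (hK.cone i).nonempty.mono hsub
  have heq : openPoly W₀ = K i := by
    refine hK.maximal i _ (isOpenConvexCone_openPoly hne) hsub fun J hiJ hJ => ⟨w J, ?_, ?_⟩
    · intro x hx
      exact hx _ (Finset.mem_image_of_mem _ (Finset.mem_filter.2 ⟨Finset.mem_univ _, hiJ, hJ⟩))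
    · exact fun j hj => hw J hiJ hJ j (Finset.mem_insert_of_mem hj)
  obtain ⟨W, -, hW, hirr⟩ := exists_irredundant W₀ hne
  exact ⟨W, by rw [hW, heq], hirr⟩

omit [FiniteDimensional ℝ E] in
theorem isOpenConvexCone_add_ray {K : Set E} (hK : IsOpenConvexCone K) (p : E) :
    IsOpenConvexCone {x | ∃ t : ℝ, 0 ≤ t ∧ x - t • p ∈ K} where
  isOpen := by
    have : {x | ∃ t : ℝ, 0 ≤ t ∧ x - t • p ∈ K} =
        ⋃ t : {t : ℝ // 0 ≤ t}, {x | x - (t : ℝ) • p ∈ K} := by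
      ext x; simp
    rw [this]
    exact isOpen_iUnion fun t => hK.isOpen.preimage (by fun_prop)
  convex := by
    rintro x ⟨t, ht, hx⟩ y ⟨u, hu, hy⟩ a b ha hb hab
    refine ⟨a * t + b * u, by positivity, ?_⟩
    convert hK.convex hx hy ha hb hab using 1
    module
  nonempty := by
    obtain ⟨q, hq⟩ := hK.nonempty
    exact ⟨q, 0, le_rfl, by simpa using hq⟩
  smul_mem := by
    rintro c hc x ⟨t, ht, hx⟩
    refine ⟨c * t, by positivity, ?_⟩
    convert hK.smul_mem c hc _ hx using 1
    module

/-- Every facet of a cone of a maximal family is blocked by some of the other cones. -/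
theorem IsMaximalTameFamily.exists_facet_relation [Finite ι] {K : ι → Set E}
    (hK : IsMaximalTameFamily K) {W : ι → Finset E} (hW : ∀ s, K s = openPoly (W s)) (i : ι)
    {v x : E} (hv : v ∈ W i) (hx : inner ℝ v x = 0) :
    ∃ S : Finset ι, i ∈ S ∧ S.card ≤ Module.finrank ℝ E ∧ ∃ y : ι → E,
      (∀ s ∈ S, y s ∈ closedPoly (W s)) ∧ x + ∑ s ∈ S, y s = 0 := by
  classical
  have := Fintype.ofFinite ι
  obtain ⟨q, hq⟩ := (hK.cone i).nonempty
  have hvq : 0 < inner ℝ v q := by rw [hW] at hq; exact hq v hv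
  let Z : Finset ι → Set E :=
    fun S => {x | ∃ y : ι → E, (∀ s ∈ S, y s ∈ closedPoly (W s)) ∧ ∑ s ∈ S, y s = x}
  let 𝓢 : Set (Finset ι) := {S | i ∈ S ∧ S.card ≤ Module.finrank ℝ E}
  have hclosed : IsClosed (⋃ S ∈ 𝓢, Z S) :=
    (Set.toFinite 𝓢).isClosed_biUnion fun S _ => isClosed_sum_closedPoly W S
  -- Push `x` out through the facet to `p = x - ε • q` and add the ray of `p` to the cone.
  -- Maximality blocks this enlargement; closedness of the finite union then allows `ε → 0`.
  have hmem : ∀ ε : ℝ, 0 < ε → ε • q - x ∈ ⋃ S ∈ 𝓢, Z S := by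
    intro ε hε
    set p := x - ε • q with hp
    set K' : Set E := {x | ∃ t : ℝ, 0 ≤ t ∧ x - t • p ∈ K i} with hK'
    have hK'c : IsOpenConvexCone K' := isOpenConvexCone_add_ray (hK.cone i) p
    have hsub : K i ⊆ K' := fun a ha => ⟨0, le_rfl, by simpa using ha⟩
    have hneq : K' ≠ K i := by
      intro h
      -- This point is `ε⁻¹ • x`, where `v` vanishes.
      have hmem : q + ε⁻¹ • p ∈ K' := ⟨ε⁻¹, by positivity, by simpa using hq⟩
      rw [h, hW] at hmem
      have := hmem v hv
      rw [hp, smul_sub, smul_smul, inv_mul_cancel₀ hε.ne', one_smul, add_sub_cancel,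
        inner_smul_right, hx, mul_zero] at this
      exact lt_irrefl _ this
    obtain ⟨J, hiJ, hJ, hno⟩ : ∃ J : Finset ι, i ∉ J ∧ J.card + 1 ≤ Module.finrank ℝ E ∧
        ¬ ∃ w : E, PosOn w K' ∧ ∀ j ∈ J, PosOn w (K j) := by
      by_contra! hcon
      exact hneq (hK.maximal i K' hK'c hsub fun J h1 h2 => hcon J h1 h2)
    have hcard : (insert i J).card ≤ Module.finrank ℝ E := by
      rw [Finset.card_insert_of_notMem hiJ]; exact hJ
    have hupd : ∀ j ∈ J, Function.update K i K' j = K j := fun j hj =>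
      Function.update_of_ne (ne_of_mem_of_not_mem hj hiJ) _ _
    obtain ⟨ξ, hξ, hξsum⟩ := (exists_posOn_or_sum_eq_zero (K := Function.update K i K')
      (Finset.insert_nonempty i J) (by
        intro s hs
        rcases Finset.mem_insert.1 hs with rfl | hs
        · rwa [Function.update_self]
        · rw [hupd s hs]; exact hK.cone s)).resolve_left (by
      rintro ⟨w, hw⟩
      refine hno ⟨w, ?_, fun j hj => ?_⟩
      · simpa using hw i (Finset.mem_insert_self _ _)
      · simpa [hupd j hj] using hw j (Finset.mem_insert_of_mem hj))
    obtain ⟨t, ht, hti⟩ : ξ i ∈ K' := by simpa using hξ i (Finset.mem_insert_self _ _)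
    have hξJ : ∀ j ∈ J, ξ j ∈ K j := fun j hj => by
      simpa [hupd j hj] using hξ j (Finset.mem_insert_of_mem hj)
    rw [Finset.sum_insert hiJ] at hξsum
    -- With `t = 0` the relation would involve only the original cones, against tameness.
    rcases ht.eq_or_lt with rfl | ht
    · exfalso
      obtain ⟨w, hw⟩ := hK.tame (insert i J) hcard
      rw [zero_smul, sub_zero] at hti
      have h1 := hw i (Finset.mem_insert_self _ _) _ hti
      have h2 : 0 ≤ ∑ j ∈ J, inner ℝ w (ξ j) := Finset.sum_nonneg fun j hj =>
        (hw j (Finset.mem_insert_of_mem hj) _ (hξJ j hj)).le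
      have h3 := congrArg (inner ℝ w) hξsum
      rw [inner_add_right, inner_sum, inner_zero_right] at h3
      linarith
    refine Set.mem_biUnion (x := insert i J) ⟨Finset.mem_insert_self _ _, hcard⟩
      ⟨fun s => t⁻¹ • if s = i then ξ i - t • p else ξ s, fun s hs => ?_, ?_⟩
    · refine closedPoly_smul_mem (inv_nonneg.2 ht.le) (openPoly_subset_closedPoly _ ?_)
      rw [← hW]
      split_ifs with h
      · rw [h]; exact hti
      · exact hξJ s ((Finset.mem_insert.1 hs).resolve_left h)
    · rw [← Finset.smul_sum, Finset.sum_insert hiJ, if_pos rfl,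
        Finset.sum_congr rfl fun j hj => if_neg (ne_of_mem_of_not_mem hj hiJ),
        sub_add_eq_add_sub, hξsum, zero_sub, smul_neg, smul_smul, inv_mul_cancel₀ ht.ne', one_smul,
        hp, neg_sub]
  have hlim : -x ∈ ⋃ S ∈ 𝓢, Z S := by
    have hc : Continuous fun ε : ℝ => ε • q - x := by fun_prop
    have h0 := (hc.tendsto 0).mono_left (nhdsWithin_le_nhds (s := Set.Ioi 0))
    simp only [zero_smul, zero_sub] at h0
    exact hclosed.mem_of_tendsto h0 (eventually_mem_nhdsWithin.mono fun ε hε => hmem ε hε)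
  obtain ⟨S, ⟨hiS, hS⟩, y, hy, hsum⟩ := Set.mem_iUnion₂.1 hlim
  exact ⟨S, hiS, hS, y, hy, by rw [hsum, add_neg_cancel]⟩

/-- In a maximal family, each facet hyperplane of a cone has every other cone either in its
positive open half-space or, away from the origin, strictly on its negative side. -/
theorem IsMaximalTameFamily.posOn_or_neg [Finite ι] {K : ι → Set E}
    (hK : IsMaximalTameFamily K) {W : ι → Finset E} (hW : ∀ s, K s = openPoly (W s)) (i : ι)
    {v x : E} (hv : v ∈ W i) (hx : inner ℝ v x = 0)
    (hxW : ∀ w ∈ W i, w ≠ v → 0 < inner ℝ w x) (l : ι) :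
    PosOn v (K l) ∨ ∀ z ∈ closedPoly (W l), z ≠ 0 → inner ℝ v z < 0 := by
  classical
  have hne : ∀ s, (openPoly (W s)).Nonempty := fun s => hW s ▸ (hK.cone s).nonempty
  obtain ⟨S, hiS, hScard, y, hy, hsum⟩ := hK.exists_facet_relation hW i hv hx
  obtain ⟨q, hq⟩ := hne i
  have hxi : x ∈ closedPoly (W i) := fun w hw => by
    rcases eq_or_ne w v with rfl | h
    · exact hx.ge
    · exact (hxW w hw h).le
  -- The relation gives `⟪w, x⟫ ≤ 0`, so `w` is a positive multiple of `v`.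
  have hprop : ∀ w : E, (∀ s ∈ S, PosOn w (openPoly (W s))) →
      ∀ y, 0 < inner ℝ w y → 0 < inner ℝ v y := by
    intro w hw
    have hwx : inner ℝ w x ≤ 0 := by
      have h1 : 0 ≤ ∑ s ∈ S, inner ℝ w (y s) := Finset.sum_nonneg fun s hs =>
        (hw s hs).nonneg_of_mem_closedPoly (hne s) (hy s hs)
      have h2 := congrArg (inner ℝ w) hsum
      rw [inner_add_right, inner_sum, inner_zero_right] at h2
      linarith
    intro u hu
    have h1 := inner_mul_eq_of_facet hx hxW
      (fun y hy => (hw i hiS).nonneg_of_mem_closedPoly (hne i) hy) hwx q u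
    have h2 := mul_pos (hq v hv) hu
    rw [h1] at h2
    exact pos_of_mul_pos_left h2 (hw i hiS q hq).le
  obtain ⟨w, hw⟩ := hK.tame S hScard
  simp only [hW] at hw
  have hvS : ∀ s ∈ S, PosOn v (openPoly (W s)) := fun s hs y hy =>
    hprop w hw y (hw s hs y hy)
  by_contra! hcon
  obtain ⟨hnot, z₁, hz₁, hz₁0, hz₁v⟩ := hcon
  rw [hW] at hnot
  have hlS : l ∉ S := fun h => hnot (hvS l h)
  obtain ⟨z₂, hz₂, hz₂v⟩ : ∃ z₂ ∈ openPoly (W l), inner ℝ v z₂ ≤ 0 := by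
    simpa [PosOn] using hnot
  obtain ⟨z, hz, hz0, hzv⟩ : ∃ z ∈ closedPoly (W l), z ≠ 0 ∧ inner ℝ v z = 0 := by
    rcases hz₁v.eq_or_lt with h | h
    · exact ⟨z₁, hz₁, hz₁0, h.symm⟩
    refine ⟨inner ℝ v z₁ • z₂ + (-inner ℝ v z₂) • z₁,
      closedPoly_add_mem (closedPoly_smul_mem h.le (openPoly_subset_closedPoly _ hz₂))
        (closedPoly_smul_mem (neg_nonneg.2 hz₂v) hz₁), fun h0 => ?_, ?_⟩
    · obtain ⟨w, hw⟩ := hK.tame {l} (by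
        rw [Finset.card_singleton]
        exact (Finset.card_pos.2 ⟨i, hiS⟩).trans_le hScard)
      have hwl := hw l (Finset.mem_singleton_self _)
      rw [hW] at hwl
      have h1 := congrArg (inner ℝ w) h0
      rw [inner_add_right, inner_smul_right, inner_smul_right, inner_zero_right] at h1
      have h2 := mul_pos h (hwl z₂ hz₂)
      have h3 := mul_nonneg (neg_nonneg.2 hz₂v) (hwl.nonneg_of_mem_closedPoly (hne l) hz₁)
      linarith
    · rw [inner_add_right, inner_smul_right, inner_smul_right]; ring
  -- Split `x` as `δ • z + (x - δ • z)`; the second part stays in the closed cone of `i` and is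
  -- absorbed into `y i`, leaving a relation that starts with a point of the closed cone of `l`.
  obtain ⟨δ, hδ, hmem⟩ := exists_add_smul_mem_closedPoly (u := -z) hx hxW (by
    rw [inner_neg_right, hzv, neg_zero])
  obtain ⟨w', hw'⟩ := exists_posOn_insert (W := W) (S := S) (l := l) (v := v) (z := δ • z)
    (y := fun s => if s = i then (x + δ • -z) + y s else y s)
    (fun s _ => hne s) hlS hScard
    (fun T _ hT => by
      obtain ⟨w, hw⟩ := hK.tame T hT
      exact ⟨w, fun s hs => hW s ▸ hw s hs⟩)
    hvS (by rw [inner_smul_right, hzv, mul_zero]) (closedPoly_smul_mem hδ.le hz)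
    (smul_ne_zero hδ.ne' hz0)
    (fun s hs => by
      split_ifs with h
      · subst h; exact closedPoly_add_mem hmem (hy s hs)
      · exact hy s hs)
    (by
      rw [← Finset.add_sum_erase _ _ hiS, if_pos rfl,
        Finset.sum_congr rfl fun s hs => if_neg (Finset.ne_of_mem_erase hs), add_assoc,
        Finset.add_sum_erase _ _ hiS, ← hsum]
      module)
  have := hprop w' fun s hs => hw' s (Finset.mem_insert_of_mem hs)
  exact hnot fun y hy => this y (hw' l (Finset.mem_insert_self _ _) y hy)

end MaximalFamily

/-! ### From `n` points to `n` connected sets. -/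

section FewComponents

variable {E : Type*} [NormedAddCommGroup E] [InnerProductSpace ℝ E] [FiniteDimensional ℝ E]
  {ι : Type*}

-- Subtract `∑ c` times the relation `a` from a relation `c` with `c k₀ = 0`: the coefficients then
-- sum to zero, so all vanish, and the one at `k₀` gives `∑ c = 0`.
omit [FiniteDimensional ℝ E] in
theorem linearIndependent_of_affineIndependent_of_sum_eq_zero {κ : Type*} [Fintype κ]
    [DecidableEq κ] {z : κ → E} (hz : AffineIndependent ℝ z) {a : κ → ℝ} (ha : ∀ k, 0 < a k)
    (ha1 : ∑ k, a k = 1) (ha0 : ∑ k, a k • z k = 0) (k₀ : κ) :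
    LinearIndependent ℝ fun k : {k // k ≠ k₀} => z k := by
  rw [Fintype.linearIndependent_iff]
  intro g hg
  let c : κ → ℝ := fun k => if h : k ≠ k₀ then g ⟨k, h⟩ else 0
  have hc0 : c k₀ = 0 := by simp [c]
  have hc : ∀ k : {k // k ≠ k₀}, c k = g k := fun k => by simp [c, k.2]
  have hcz : ∑ k, c k • z k = 0 := by
    rw [← Finset.add_sum_erase _ _ (Finset.mem_univ k₀), hc0, zero_smul, zero_add, ← hg,
      Finset.sum_subtype (p := fun k => k ≠ k₀) (F := inferInstance) (Finset.univ.erase k₀)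
        (by simp) (fun k => c k • z k)]
    exact Finset.sum_congr rfl fun k _ => by rw [hc]
  have h := affineIndependent_iff.1 hz Finset.univ (fun k => c k - (∑ j, c j) * a k)
    (by rw [Finset.sum_sub_distrib, ← Finset.mul_sum, ha1, mul_one, sub_self])
    (by simp only [sub_smul, Finset.sum_sub_distrib, mul_smul, ← Finset.smul_sum, hcz, ha0,
          smul_zero, sub_zero])
  have h0 := h k₀ (Finset.mem_univ _)
  rw [hc0, zero_sub, neg_eq_zero] at h0
  have hsum := (mul_eq_zero.1 h0).resolve_right (ha k₀).ne'
  intro k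
  have := h k (Finset.mem_univ _)
  rw [hsum, zero_mul, sub_zero, hc] at this
  exact this

/-- If every `n` points of a union of at most `n` connected sets in an `n`-dimensional space lie
in an open half-space, then the origin is not in the convex hull of the union. -/
theorem zero_notMem_convexHull_iUnion {A : ι → Set E} {S : Finset ι}
    (hS : S.card ≤ Module.finrank ℝ E) (hA : ∀ s ∈ S, IsPreconnected (A s))
    (h : ∀ F : Finset E, F.card ≤ Module.finrank ℝ E → (F : Set E) ⊆ ⋃ s ∈ S, A s →
      ∃ w : E, ∀ x ∈ F, 0 < inner ℝ w x) :
    (0 : E) ∉ convexHull ℝ (⋃ s ∈ S, A s) := by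
  classical
  intro h0
  obtain ⟨κ, _, z, a, hzA, hzind, ha, ha1, ha0⟩ := eq_pos_convex_span_of_mem_convexHull h0
  have hne : (Finset.univ : Finset κ).Nonempty := by
    rw [Finset.nonempty_iff_ne_empty]
    intro he
    rw [he] at ha1
    simp at ha1
  have hz : ∀ k, z k ∈ ⋃ s ∈ S, A s := fun k => hzA ⟨k, rfl⟩
  by_cases hcard : Fintype.card κ ≤ Module.finrank ℝ E
  · obtain ⟨w, hw⟩ := h (Finset.univ.image z) (Finset.card_image_le.trans hcard)
      (by rintro _ hx; obtain ⟨k, -, rfl⟩ := Finset.mem_image.1 hx; exact hz k)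
    have h1 := congrArg (inner ℝ w) ha0
    simp only [inner_sum, inner_smul_right, inner_zero_right] at h1
    have h2 : 0 < ∑ k, a k * inner ℝ w (z k) := Finset.sum_pos (fun k _ =>
      mul_pos (ha k) (hw _ (Finset.mem_image_of_mem _ (Finset.mem_univ k)))) hne
    linarith
  have hcard' : Fintype.card κ = Module.finrank ℝ E + 1 := by
    have h1 := hzind.card_le_finrank_succ
    have h2 := Submodule.finrank_le (vectorSpan ℝ (Set.range z))
    omega
  have hs : ∀ k, ∃ s ∈ S, z k ∈ A s := fun k => by simpa using hz k
  choose s hsS hsz using hs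
  -- Carathéodory leaves `n + 1` points in at most `n` sets, so two share a set. The points other
  -- than `z k₀` form a basis.
  obtain ⟨k₀, -, k₁, -, hk, hsk⟩ := Finset.exists_ne_map_eq_of_card_lt_of_maps_to
    (s := (Finset.univ : Finset κ)) (t := S) (f := s)
    (by rw [Finset.card_univ]; omega) (fun k _ => hsS k)
  have hli := linearIndependent_of_affineIndependent_of_sum_eq_zero hzind ha ha1 ha0 k₀
  have : Nonempty {k // k ≠ k₀} := ⟨⟨k₁, hk.symm⟩⟩
  let b := basisOfLinearIndependentOfCardEqFinrank hli (by
    rw [Fintype.card_subtype_compl, Fintype.card_subtype_eq]; omega)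
  have hb : ∀ k, b k = z k := fun k => by simp [b]
  have hcont : ∀ j, Continuous (b.coord j) := fun j => (b.coord j).continuous_of_finiteDimensional
  have hneg : ∀ j, b.coord j (z k₀) < 0 := by
    intro j
    have h1 := congrArg (b.coord j) ha0
    rw [← Finset.add_sum_erase _ _ (Finset.mem_univ k₀),
      Finset.sum_subtype (p := fun k => k ≠ k₀) (F := inferInstance) (Finset.univ.erase k₀)
        (by simp) (fun k => a k • z k)] at h1
    simp only [← hb] at h1
    rw [map_add, map_smul, map_zero, map_sum, Finset.sum_eq_single j] at h1
    · simp only [map_smul, Module.Basis.coord_apply, Module.Basis.repr_self,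
        Finsupp.single_eq_same, smul_eq_mul, mul_one] at h1
      have h2 := ha k₀
      have h3 := ha j
      rw [Module.Basis.coord_apply]
      by_contra! h4
      have := mul_nonneg h2.le h4
      linarith
    · intro i _ hij
      simp [hij]
    · simp
  have hpos : 0 < b.coord ⟨k₁, hk.symm⟩ (z k₁) := by
    have : z k₁ = b ⟨k₁, hk.symm⟩ := (hb ⟨k₁, hk.symm⟩).symm
    rw [this]
    simp
  -- The common set joins `z k₀`, in the open negative orthant, to the basis vector `z k₁`, so it
  -- meets the boundary of that orthant.
  obtain ⟨q, hqA, hq, j, hj⟩ : ∃ q ∈ A (s k₀), (∀ j, b.coord j q ≤ 0) ∧ ∃ j, b.coord j q = 0 := by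
    by_contra! hcon
    obtain ⟨x, -, ⟨j, hxj⟩, hx⟩ := hA (s k₀) (hsS k₀) {x | ∃ j, 0 < b.coord j x}
      {x | ∀ j, b.coord j x < 0}
      (by
        have : {x | ∃ j, 0 < b.coord j x} = ⋃ j, {x | 0 < b.coord j x} := by ext; simp
        rw [this]
        exact isOpen_iUnion fun j => isOpen_lt continuous_const (hcont j))
      (by
        have : {x | ∀ j, b.coord j x < 0} = ⋂ j, {x | b.coord j x < 0} := by ext; simp
        rw [this]
        exact isOpen_iInter_of_finite fun j => isOpen_lt (hcont j) continuous_const)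
      (fun x hx => by
        by_cases h : ∃ j, 0 < b.coord j x
        · exact Or.inl h
        · push Not at h
          exact Or.inr fun j => lt_of_le_of_ne (h j) (hcon x hx h j))
      ⟨z k₁, hsk ▸ hsz k₁, ⟨_, hpos⟩⟩ ⟨z k₀, hsz k₀, hneg⟩
    exact lt_asymm hxj (hx j)
  -- As the coordinate `j` of `q` is zero, `z j` can be dropped. That leaves at most `n` points,
  -- while `-q` is a nonnegative combination of those other than `q`.
  obtain ⟨w, hw⟩ := h (insert q (((Finset.univ.erase k₀).erase j).image z))
    (by
      refine (Finset.card_insert_le _ _).trans ?_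
      have h1 := Finset.card_image_le (s := (Finset.univ.erase k₀).erase (j : κ)) (f := z)
      rw [Finset.card_erase_of_mem (by simp [j.2]), Finset.card_erase_of_mem (Finset.mem_univ _),
        Finset.card_univ] at h1
      have := Finset.card_pos.2 ⟨s k₀, hsS k₀⟩
      omega)
    (by
      intro x hx
      rcases Finset.mem_insert.1 hx with rfl | hx
      · exact Set.mem_biUnion (hsS k₀) hqA
      · obtain ⟨k, -, rfl⟩ := Finset.mem_image.1 hx
        exact hz k)
  have h1 := hw q (Finset.mem_insert_self _ _)
  rw [← b.sum_repr q, inner_sum] at h1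
  refine absurd h1 (not_lt.2 (Finset.sum_nonpos fun i _ => ?_))
  rw [inner_smul_right]
  rcases eq_or_ne i j with rfl | hij
  · have : b.repr q i = 0 := hj
    rw [this, zero_mul]
  · refine mul_nonpos_of_nonpos_of_nonneg (hq i) (hw _ ?_).le
    rw [hb]
    refine Finset.mem_insert_of_mem (Finset.mem_image_of_mem _ ?_)
    simp [i.2, Subtype.coe_ne_coe.2 hij]

end FewComponents

/-! ### Connected components of a subset. -/

section Components

variable {X : Type*} [TopologicalSpace X]

theorem subset_of_mem_componentsOf {U C : Set X} (hC : C ∈ componentsOf U) : C ⊆ U := by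
  obtain ⟨x, -, rfl⟩ := hC
  exact connectedComponentIn_subset U x

theorem nonempty_of_mem_componentsOf {U C : Set X} (hC : C ∈ componentsOf U) : C.Nonempty := by
  obtain ⟨x, hx, rfl⟩ := hC
  exact ⟨x, mem_connectedComponentIn hx⟩

theorem isPreconnected_of_mem_componentsOf {U C : Set X} (hC : C ∈ componentsOf U) :
    IsPreconnected C := by
  obtain ⟨x, -, rfl⟩ := hC
  exact isPreconnected_connectedComponentIn

theorem exists_mem_componentsOf {U : Set X} {x : X} (hx : x ∈ U) : ∃ C ∈ componentsOf U, x ∈ C :=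
  ⟨_, ⟨x, hx, rfl⟩, mem_connectedComponentIn hx⟩

theorem subset_of_inter_nonempty {U C A : Set X} (hC : C ∈ componentsOf U) (hA : IsPreconnected A)
    (hAU : A ⊆ U) (hne : (C ∩ A).Nonempty) : A ⊆ C := by
  obtain ⟨x, -, rfl⟩ := hC
  obtain ⟨y, hyC, hyA⟩ := hne
  rw [connectedComponentIn_eq hyC]
  exact hA.subset_connectedComponentIn hyA hAU

theorem eq_of_mem_componentsOf {U C D : Set X} (hC : C ∈ componentsOf U) (hD : D ∈ componentsOf U)
    {x : X} (hxC : x ∈ C) (hxD : x ∈ D) : C = D :=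
  Set.Subset.antisymm
    (subset_of_inter_nonempty hD (isPreconnected_of_mem_componentsOf hC)
      (subset_of_mem_componentsOf hC) ⟨x, hxD, hxC⟩)
    (subset_of_inter_nonempty hC (isPreconnected_of_mem_componentsOf hD)
      (subset_of_mem_componentsOf hD) ⟨x, hxC, hxD⟩)

/-- Components are relatively closed in `U`; finiteness makes the union of the others relatively
closed too, so local connectedness of `X` is not needed. -/
theorem isOpen_of_mem_componentsOf {U C : Set X} (hU : IsOpen U) (hfin : (componentsOf U).Finite)
    (hC : C ∈ componentsOf U) : IsOpen C := by
  have hclosed : ∀ D ∈ componentsOf U, closure D ∩ U ⊆ D := fun D hD =>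
    subset_of_inter_nonempty hD
      ((isPreconnected_of_mem_componentsOf hD).subset_closure
        (Set.subset_inter subset_closure (subset_of_mem_componentsOf hD)) Set.inter_subset_left)
      Set.inter_subset_right (by
        obtain ⟨x, hx⟩ := nonempty_of_mem_componentsOf hD
        exact ⟨x, hx, subset_closure hx, subset_of_mem_componentsOf hD hx⟩)
  have : C = U ∩ (⋃ D ∈ componentsOf U \ {C}, closure D)ᶜ := by
    ext x
    constructor
    · intro hx
      refine ⟨subset_of_mem_componentsOf hC hx, fun h => ?_⟩
      obtain ⟨D, hD, hxD⟩ := Set.mem_iUnion₂.1 h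
      exact hD.2 (eq_of_mem_componentsOf hD.1 hC
        (hclosed D hD.1 ⟨hxD, subset_of_mem_componentsOf hC hx⟩) hx)
    · rintro ⟨hxU, hx⟩
      obtain ⟨D, hD, hxD⟩ := exists_mem_componentsOf hxU
      by_contra hxC
      exact hx (Set.mem_biUnion (x := D) ⟨hD, fun h => hxC (h ▸ hxD)⟩ (subset_closure hxD))
  rw [this]
  exact hU.inter ((hfin.subset Set.sdiff_subset).isClosed_biUnion
    fun _ _ => isClosed_closure).isOpen_compl

theorem encard_componentsOf_iUnion_le {κ : Type*} {f : κ → Set X}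
    (hf : ∀ k, IsPreconnected (f k)) : (componentsOf (⋃ k, f k)).encard ≤ ENat.card κ := by
  classical
  let g : κ → Set X := fun k =>
    if h : (f k).Nonempty then connectedComponentIn (⋃ k, f k) h.some else ∅
  have hsub : componentsOf (⋃ k, f k) ⊆ g '' Set.univ := by
    rintro _ ⟨x, hx, rfl⟩
    obtain ⟨k, hk⟩ := Set.mem_iUnion.1 hx
    have hne : (f k).Nonempty := ⟨x, hk⟩
    refine ⟨k, Set.mem_univ _, ?_⟩
    simp only [g, dif_pos hne]
    exact (connectedComponentIn_eq ((hf k).subset_connectedComponentIn hk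
      (Set.subset_iUnion f k) hne.some_mem)).symm
  refine (Set.encard_le_encard hsub).trans ((Set.encard_image_le _ _).trans ?_)
  rw [Set.encard_univ]

end Components

/-! ### Passage between subsets of the sphere and cones. -/

section Sphere

variable {n : ℕ}

/-- The open cone over a subset of the sphere. -/
def coneOver (C : Set (Sph n)) : Set (EuclideanSpace ℝ (Fin n)) :=
  {y | ∃ t : ℝ, 0 < t ∧ ∃ x ∈ C, y = t • (x : EuclideanSpace ℝ (Fin n))}

/-- The trace of a cone on the sphere. -/
def sphereTrace (K : Set (EuclideanSpace ℝ (Fin n))) : Set (Sph n) := {x | ↑x ∈ K}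

theorem coe_mem_coneOver {C : Set (Sph n)} {x : Sph n} :
    (x : EuclideanSpace ℝ (Fin n)) ∈ coneOver C ↔ x ∈ C := by
  constructor
  · rintro ⟨t, ht, y, hy, h⟩
    have h1 := congrArg norm h
    rw [norm_smul, norm_eq_of_mem_sphere, norm_eq_of_mem_sphere, mul_one, Real.norm_of_nonneg ht.le]
      at h1
    rw [← h1, one_smul] at h
    rwa [Subtype.ext h]
  · exact fun hx => ⟨1, one_pos, x, hx, (one_smul _ _).symm⟩

theorem zero_notMem_coneOver (C : Set (Sph n)) : 0 ∉ coneOver C := by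
  rintro ⟨t, ht, x, -, h⟩
  exact smul_ne_zero ht.ne' (ne_zero_of_mem_unit_sphere x) h.symm

theorem coneOver_smul_mem {C : Set (Sph n)} {t : ℝ} (ht : 0 < t) {y : EuclideanSpace ℝ (Fin n)}
    (hy : y ∈ coneOver C) : t • y ∈ coneOver C := by
  obtain ⟨u, hu, x, hx, rfl⟩ := hy
  exact ⟨t * u, mul_pos ht hu, x, hx, smul_smul _ _ _⟩

theorem inv_norm_smul_mem_sphere {y : EuclideanSpace ℝ (Fin n)} (hy : y ≠ 0) :
    ‖y‖⁻¹ • y ∈ Metric.sphere (0 : EuclideanSpace ℝ (Fin n)) 1 := by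
  rw [mem_sphere_zero_iff_norm, norm_smul, norm_inv, norm_norm,
    inv_mul_cancel₀ (norm_ne_zero_iff.2 hy)]

theorem mem_coneOver_iff {C : Set (Sph n)} {y : EuclideanSpace ℝ (Fin n)} (hy : y ≠ 0) :
    y ∈ coneOver C ↔ (⟨‖y‖⁻¹ • y, inv_norm_smul_mem_sphere hy⟩ : Sph n) ∈ C := by
  have hn := norm_pos_iff.2 hy
  rw [← coe_mem_coneOver]
  constructor
  · exact fun h => coneOver_smul_mem (inv_pos.2 hn) h
  · intro h
    have := coneOver_smul_mem hn h
    rwa [smul_smul, mul_inv_cancel₀ hn.ne', one_smul] at this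

theorem isOpen_coneOver {C : Set (Sph n)} (hC : IsOpen C) : IsOpen (coneOver C) := by
  obtain ⟨O, hO, rfl⟩ := isOpen_induced_iff.1 hC
  have hc : ContinuousOn (fun y : EuclideanSpace ℝ (Fin n) => ‖y‖⁻¹ • y) {0}ᶜ :=
    (continuousOn_id.norm.inv₀ fun y hy => norm_ne_zero_iff.2 hy).smul continuousOn_id
  convert hc.isOpen_inter_preimage isOpen_compl_singleton hO using 1
  ext y
  by_cases hy : y = 0
  · subst hy
    simpa using zero_notMem_coneOver _
  · rw [mem_coneOver_iff hy]
    simp [hy]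

theorem isPreconnected_coneOver {C : Set (Sph n)} (hC : IsPreconnected C) :
    IsPreconnected (coneOver C) := by
  have : coneOver C = (fun p : ℝ × Sph n => p.1 • (p.2 : EuclideanSpace ℝ (Fin n))) ''
      (Set.Ioi 0 ×ˢ C) := by
    ext y
    constructor
    · rintro ⟨t, ht, x, hx, rfl⟩
      exact ⟨(t, x), ⟨ht, hx⟩, rfl⟩
    · rintro ⟨⟨t, x⟩, ⟨ht, hx⟩, rfl⟩
      exact ⟨t, ht, x, hx, rfl⟩
  rw [this]
  exact (isPreconnected_Ioi.prod hC).image _ (by fun_prop)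

theorem isPreconnected_sphereTrace {K : Set (EuclideanSpace ℝ (Fin n))} (hK : Convex ℝ K)
    (hsmul : ∀ t : ℝ, 0 < t → ∀ x ∈ K, t • x ∈ K) (h0 : 0 ∉ K) :
    IsPreconnected (sphereTrace K) := by
  rw [← Topology.IsInducing.subtypeVal.isPreconnected_image]
  have hc : ContinuousOn (fun y : EuclideanSpace ℝ (Fin n) => ‖y‖⁻¹ • y) K :=
    (continuousOn_id.norm.inv₀ fun y hy => norm_ne_zero_iff.2 fun h => h0 (h ▸ hy)).smul
      continuousOn_id
  convert hK.isPreconnected.image _ hc using 1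
  ext y
  constructor
  · rintro ⟨x, hx, rfl⟩
    exact ⟨x, hx, by simp⟩
  · rintro ⟨y, hy, rfl⟩
    have hy0 : y ≠ 0 := fun h => h0 (h ▸ hy)
    exact ⟨⟨_, inv_norm_smul_mem_sphere hy0⟩, hsmul _ (inv_pos.2 (norm_pos_iff.2 hy0)) y hy, rfl⟩

theorem isOpen_sphereTrace {K : Set (EuclideanSpace ℝ (Fin n))} (hK : IsOpen K) :
    IsOpen (sphereTrace K) := hK.preimage continuous_subtype_val

theorem subset_coneOver_of_sphereTrace_subset {C : Set (Sph n)}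
    {K : Set (EuclideanSpace ℝ (Fin n))}
    (hsmul : ∀ t : ℝ, 0 < t → ∀ x ∈ K, t • x ∈ K) (h0 : 0 ∉ K) (h : sphereTrace K ⊆ C) :
    K ⊆ coneOver C := by
  intro y hy
  have hy0 : y ≠ 0 := fun h => h0 (h ▸ hy)
  rw [mem_coneOver_iff hy0]
  exact h (hsmul _ (inv_pos.2 (norm_pos_iff.2 hy0)) y hy)

theorem zero_notMem_of_posOn {K : Set (EuclideanSpace ℝ (Fin n))} {w : EuclideanSpace ℝ (Fin n)}
    (h : PosOn w K) : 0 ∉ K := fun h0 => by simpa using h 0 h0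

theorem PosOn.convexHull {K : Set (EuclideanSpace ℝ (Fin n))} {w : EuclideanSpace ℝ (Fin n)}
    (h : PosOn w K) : PosOn w (convexHull ℝ K) :=
  convexHull_min h (convex_halfSpace_gt
    (f := fun x => inner ℝ w x) ⟨fun _ _ => inner_add_right _ _ _,
      fun _ _ => inner_smul_right _ _ _⟩ 0)

theorem posOn_coneOver_iff {C : Set (Sph n)} {w : EuclideanSpace ℝ (Fin n)} :
    PosOn w (coneOver C) ↔ ∀ x ∈ C, 0 < inner ℝ w (x : EuclideanSpace ℝ (Fin n)) := by
  constructor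
  · exact fun h x hx => h _ (coe_mem_coneOver.2 hx)
  · rintro h _ ⟨t, ht, x, hx, rfl⟩
    rw [inner_smul_right]
    exact mul_pos ht (h x hx)

theorem setOf_inner_pos_eq_openHemisphere {w : EuclideanSpace ℝ (Fin n)} (hw : w ≠ 0) :
    {x : Sph n | 0 < inner ℝ w (x : EuclideanSpace ℝ (Fin n))} =
      openHemisphere ⟨‖w‖⁻¹ • w, inv_norm_smul_mem_sphere hw⟩ := by
  ext x
  simp only [openHemisphere, Set.mem_ofPred_eq, real_inner_smul_left]
  exact (mul_pos_iff_of_pos_left (inv_pos.2 (norm_pos_iff.2 hw))).symm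

theorem isTame_iff {m : ℕ} {V : Set (Sph n)} :
    IsTame m V ↔ ∀ F : Finset (Sph n), F.card ≤ m → (F : Set (Sph n)) ⊆ V →
      ∃ w : EuclideanSpace ℝ (Fin n), ∀ x ∈ F, 0 < inner ℝ w (x : EuclideanSpace ℝ (Fin n)) := by
  constructor
  · intro h F hF hFV
    rcases F.eq_empty_or_nonempty with rfl | hne
    · exact ⟨0, by simp⟩
    · obtain ⟨_, ⟨v, rfl⟩, hv⟩ := h F hne hF hFV
      exact ⟨v, fun x hx => hv hx⟩
  · intro h F hne hF hFV
    obtain ⟨w, hw⟩ := h F hF hFV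
    have hw0 : w ≠ 0 := by
      rintro rfl
      obtain ⟨x, hx⟩ := hne
      simpa using hw x hx
    exact ⟨_, ⟨_, setOf_inner_pos_eq_openHemisphere hw0⟩, hw⟩

theorem IsTame.exists_inner_pos {m : ℕ} {V : Set (Sph n)} (h : IsTame m V)
    {F : Finset (EuclideanSpace ℝ (Fin n))} (hF : F.card ≤ m)
    (hFV : (F : Set (EuclideanSpace ℝ (Fin n))) ⊆ coneOver V) :
    ∃ w : EuclideanSpace ℝ (Fin n), ∀ x ∈ F, 0 < inner ℝ w x := by
  classical
  have hex : ∀ y : F, ∃ x ∈ V, ∃ t : ℝ, 0 < t ∧ (y : EuclideanSpace ℝ (Fin n)) = t • ↑x :=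
    fun y => by
      obtain ⟨t, ht, x, hx, h⟩ := hFV y.2
      exact ⟨x, hx, t, ht, h⟩
  choose p hpV t ht hp using hex
  obtain ⟨w, hw⟩ := isTame_iff.1 h (Finset.univ.image p)
    (Finset.card_image_le.trans (by simpa using hF))
    (by rintro _ hx; obtain ⟨y, -, rfl⟩ := Finset.mem_image.1 hx; exact hpV y)
  refine ⟨w, fun y hy => ?_⟩
  rw [show y = t ⟨y, hy⟩ • (p ⟨y, hy⟩ : EuclideanSpace ℝ (Fin n)) from hp ⟨y, hy⟩,
    inner_smul_right]
  exact mul_pos (ht _) (hw _ (Finset.mem_image_of_mem _ (Finset.mem_univ _)))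

end Sphere

/-! ### Weakly maxtame sets give maximal families of cones. -/

section WeaklyMaxtame

variable {n : ℕ} {U : Set (Sph n)}

theorem pos_of_sph (x : Sph n) : 0 < n := by
  rcases Nat.eq_zero_or_pos n with rfl | h
  · exact absurd (Subsingleton.elim _ _) (ne_zero_of_mem_unit_sphere x)
  · exact h

namespace IsWeaklyMaxtame

theorem isOpen_component (hU : IsWeaklyMaxtame U) (C : componentsOf U) : IsOpen (C : Set (Sph n)) :=
  isOpen_of_mem_componentsOf hU.1 hU.2.2.1 C.2

/-- The components of a weakly maxtame set cannot be enlarged to open connected sets with tame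
union. -/
theorem eq_of_isTame_iUnion (hU : IsWeaklyMaxtame U) {f : componentsOf U → Set (Sph n)}
    (hopen : ∀ C, IsOpen (f C)) (hconn : ∀ C, IsPreconnected (f C)) (hsub : ∀ C, C.1 ⊆ f C)
    (htame : IsTame n (⋃ C, f C)) (C : componentsOf U) : f C = C := by
  have hUV : U ⊆ ⋃ C, f C := fun x hx => by
    obtain ⟨C, hC, hxC⟩ := exists_mem_componentsOf hx
    exact Set.mem_iUnion.2 ⟨⟨C, hC⟩, hsub _ hxC⟩
  have hV := hU.2.2.2 _ (isOpen_iUnion hopen) htame (encard_componentsOf_iUnion_le hconn) hUV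
  refine Set.Subset.antisymm (subset_of_inter_nonempty C.2 (hconn C) ?_ ?_) (hsub C)
  · rw [← hV]; exact Set.subset_iUnion f C
  · obtain ⟨x, hx⟩ := nonempty_of_mem_componentsOf C.2
    exact ⟨x, hx, hsub C hx⟩

theorem exists_posOn (hU : IsWeaklyMaxtame U) (S : Finset (componentsOf U)) (hS : S.card ≤ n) :
    ∃ w, ∀ C ∈ S, PosOn w (coneOver (C : Set (Sph n))) := by
  have h0 := zero_notMem_convexHull_iUnion (A := fun C : componentsOf U => coneOver C.1) (S := S)
    (by simpa using hS)
    (fun C _ => isPreconnected_coneOver (isPreconnected_of_mem_componentsOf C.2))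
    (fun F hF hFS => hU.2.1.exists_inner_pos (by simpa using hF) (hFS.trans
      (Set.iUnion₂_subset fun C _ => by
        rintro _ ⟨t, ht, x, hx, rfl⟩
        exact ⟨t, ht, x, subset_of_mem_componentsOf C.2 hx, rfl⟩)))
  obtain ⟨w, hw⟩ := exists_posOn_of_convex
    (isOpen_biUnion fun C _ => isOpen_coneOver (hU.isOpen_component C)).convexHull
    (convex_convexHull ℝ _) h0
  exact ⟨w, fun C hC x hx => hw x (subset_convexHull ℝ _ (Set.mem_biUnion hC hx))⟩

theorem exists_posOn_single (hU : IsWeaklyMaxtame U) (C : componentsOf U) :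
    ∃ w, PosOn w (coneOver (C : Set (Sph n))) := by
  obtain ⟨x, -⟩ := nonempty_of_mem_componentsOf C.2
  obtain ⟨w, hw⟩ := hU.exists_posOn {C} (by rw [Finset.card_singleton]; exact pos_of_sph x)
  exact ⟨w, hw C (Finset.mem_singleton_self _)⟩

/-- All components are replaced at once by the traces of their convex hulls. Any `n` points of the
new union involve at most `n` components, and a half-space containing these contains their hulls, so
maximality applies. -/
theorem convex_coneOver (hU : IsWeaklyMaxtame U) (C : componentsOf U) :
    Convex ℝ (coneOver (C : Set (Sph n))) := by
  classical
  have hsmul : ∀ C : componentsOf U, ∀ t : ℝ, 0 < t → ∀ x ∈ convexHull ℝ (coneOver C.1),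
      t • x ∈ convexHull ℝ (coneOver C.1) := fun C t ht x hx => by
    have h := Set.smul_mem_smul_set (a := t) hx
    rw [← convexHull_smul] at h
    refine convexHull_mono ?_ h
    rintro _ ⟨y, hy, rfl⟩
    exact coneOver_smul_mem ht hy
  have h0 : ∀ C : componentsOf U, 0 ∉ convexHull ℝ (coneOver C.1) := fun C => by
    obtain ⟨w, hw⟩ := hU.exists_posOn_single C
    exact zero_notMem_of_posOn hw.convexHull
  have heq := hU.eq_of_isTame_iUnion (f := fun C => sphereTrace (convexHull ℝ (coneOver C.1)))
    (fun C => isOpen_sphereTrace (isOpen_coneOver (hU.isOpen_component C)).convexHull)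
    (fun C => isPreconnected_sphereTrace (convex_convexHull ℝ _) (hsmul C) (h0 C))
    (fun C x hx => subset_convexHull ℝ _ (coe_mem_coneOver.2 hx))
    (isTame_iff.2 fun F hF hFV => by
      have hex : ∀ x : F, ∃ C : componentsOf U, (x : Sph n) ∈
          sphereTrace (convexHull ℝ (coneOver C.1)) := fun x => Set.mem_iUnion.1 (hFV x.2)
      choose c hc using hex
      obtain ⟨w, hw⟩ := hU.exists_posOn (Finset.univ.image c)
        (Finset.card_image_le.trans (by simpa using hF))
      exact ⟨w, fun x hx => (hw (c ⟨x, hx⟩) (Finset.mem_image_of_mem _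
        (Finset.mem_univ _))).convexHull _ (hc ⟨x, hx⟩)⟩) C
  have : convexHull ℝ (coneOver C.1) = coneOver C.1 :=
    Set.Subset.antisymm (subset_coneOver_of_sphereTrace_subset (hsmul C) (h0 C) heq.le)
      (subset_convexHull ℝ _)
  exact this ▸ convex_convexHull ℝ _

theorem isMaximalTameFamily (hU : IsWeaklyMaxtame U) :
    IsMaximalTameFamily fun C : componentsOf U => coneOver (C : Set (Sph n)) where
  cone C :=
    { isOpen := isOpen_coneOver (hU.isOpen_component C)
      convex := hU.convex_coneOver C
      nonempty := by
        obtain ⟨x, hx⟩ := nonempty_of_mem_componentsOf C.2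
        exact ⟨x, coe_mem_coneOver.2 hx⟩
      smul_mem := fun t ht x hx => coneOver_smul_mem ht hx }
  tame S hS := hU.exists_posOn S (by simpa using hS)
  maximal C K' hK' hsub htame := by
    classical
    rw [finrank_euclideanSpace_fin] at htame
    obtain ⟨x, hx⟩ := nonempty_of_mem_componentsOf C.2
    have hn := pos_of_sph x
    have h0 : 0 ∉ K' := by
      obtain ⟨w, hw, -⟩ := htame ∅ (Finset.notMem_empty _) (by rwa [Finset.card_empty, zero_add])
      exact zero_notMem_of_posOn hw
    have heq := hU.eq_of_isTame_iUnion
      (f := Function.update (fun D : componentsOf U => D.1) C (sphereTrace K'))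
      (fun D => by
        rcases eq_or_ne D C with rfl | h
        · rw [Function.update_self]; exact isOpen_sphereTrace hK'.isOpen
        · rw [Function.update_of_ne h]; exact hU.isOpen_component D)
      (fun D => by
        rcases eq_or_ne D C with rfl | h
        · rw [Function.update_self]
          exact isPreconnected_sphereTrace hK'.convex hK'.smul_mem h0
        · rw [Function.update_of_ne h]; exact isPreconnected_of_mem_componentsOf D.2)
      (fun D => by
        rcases eq_or_ne D C with rfl | h
        · rw [Function.update_self]; exact fun x hx => hsub (coe_mem_coneOver.2 hx)
        · rw [Function.update_of_ne h])
      (isTame_iff.2 fun F hF hFV => by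
        have hex : ∀ x : F, ∃ D : componentsOf U, (x : Sph n) ∈
            Function.update (fun D : componentsOf U => D.1) C (sphereTrace K') D :=
          fun x => Set.mem_iUnion.1 (hFV x.2)
        choose c hc using hex
        have hcard : (Finset.univ.image c).card ≤ n :=
          Finset.card_image_le.trans (by simpa using hF)
        have hmem : ∀ x, c x ∈ Finset.univ.image c := fun x =>
          Finset.mem_image_of_mem _ (Finset.mem_univ _)
        -- If the points involve the enlarged cone, at most `n - 1` other components occur and
        -- `htame` applies; otherwise the original family suffices.
        by_cases hC : C ∈ Finset.univ.image c
        · obtain ⟨w, hw, hwJ⟩ := htame ((Finset.univ.image c).erase C) (Finset.notMem_erase _ _) (by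
            rw [Finset.card_erase_of_mem hC]
            have := Finset.card_pos.2 ⟨C, hC⟩
            omega)
          refine ⟨w, fun x hx => ?_⟩
          have hcx := hc ⟨x, hx⟩
          by_cases h : c ⟨x, hx⟩ = C
          · rw [h, Function.update_self] at hcx
            exact hw _ hcx
          · rw [Function.update_of_ne h] at hcx
            exact hwJ _ (Finset.mem_erase.2 ⟨h, hmem _⟩) _ (coe_mem_coneOver.2 hcx)
        · obtain ⟨w, hw⟩ := hU.exists_posOn (Finset.univ.image c) hcard
          refine ⟨w, fun x hx => ?_⟩
          have hcx := hc ⟨x, hx⟩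
          rw [Function.update_of_ne (ne_of_mem_of_not_mem (hmem _) hC)] at hcx
          exact hw _ (hmem _) _ (coe_mem_coneOver.2 hcx)) C
    rw [Function.update_self] at heq
    exact Set.Subset.antisymm
      (subset_coneOver_of_sphereTrace_subset hK'.smul_mem h0 heq.le) hsub

/-- Each component is cut out by finitely many open hemispheres, whose closures are disjoint from
the closures of all components that they do not contain. -/
theorem exists_defining_functionals (hU : IsWeaklyMaxtame U) :
    ∃ W : componentsOf U → Finset (EuclideanSpace ℝ (Fin n)),
      (∀ C, coneOver C.1 = openPoly (W C)) ∧
      ∀ C, ∀ w ∈ W C, ∀ D : componentsOf U, PosOn w (coneOver D.1) ∨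
        ∀ z ∈ closure D.1, inner ℝ w (z : EuclideanSpace ℝ (Fin n)) < 0 := by
  have := hU.2.2.1.to_subtype
  have hK := hU.isMaximalTameFamily
  choose W hW hfacet using hK.exists_eq_openPoly
  refine ⟨W, hW, fun C w hw D => ?_⟩
  obtain ⟨x, hx, hxW⟩ := hfacet C w hw
  refine (hK.posOn_or_neg hW C hw hx hxW D).imp_right fun h z hz => ?_
  refine h z ?_ (ne_zero_of_mem_unit_sphere z)
  refine closure_minimal (t := sphereTrace (closedPoly (W D))) (fun y hy => ?_)
    ((isClosed_closedPoly (W D)).preimage continuous_subtype_val) hz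
  exact openPoly_subset_closedPoly _ (hW D ▸ coe_mem_coneOver.2 hy)

end IsWeaklyMaxtame

end WeaklyMaxtame

theorem theoremA (n : ℕ) (U : Set (Sph n)) (hU : IsWeaklyMaxtame U) :
    (∃ 𝓗 : Set (Set (Sph n)),
      𝓗.Finite ∧
      (∀ H ∈ 𝓗, IsOpenHemisphere H) ∧
      (∀ C ∈ componentsOf U, ∃ 𝓢 ⊆ 𝓗, 𝓢.Nonempty ∧ C = ⋂₀ 𝓢) ∧
      (∀ H ∈ 𝓗, ∃ N ∈ 𝓝ˢ (closure H), U ∩ H = U ∩ N)) ∧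
    (∀ C₁ ∈ componentsOf U, ∀ C₂ ∈ componentsOf U, C₁ ≠ C₂ →
      Disjoint (closure C₁) (closure C₂)) := by
  have hfin := hU.2.2.1.to_subtype
  obtain ⟨W, hW, hsep⟩ := hU.exists_defining_functionals
  let Hs : EuclideanSpace ℝ (Fin n) → Set (Sph n) := fun w =>
    {x | 0 < inner ℝ w (x : EuclideanSpace ℝ (Fin n))}
  have hclosure : ∀ w, closure (Hs w) ⊆ {x | 0 ≤ inner ℝ w (x : EuclideanSpace ℝ (Fin n))} :=
    fun w => closure_minimal (fun x (hx : 0 < inner ℝ w (x : EuclideanSpace ℝ (Fin n))) => hx.le)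
      (isClosed_le continuous_const (by fun_prop))
  have hmem : ∀ C : componentsOf U, ∀ x : Sph n, x ∈ C.1 ↔ ∀ w ∈ W C, x ∈ Hs w := fun C x => by
    rw [← coe_mem_coneOver, hW]; rfl
  refine ⟨⟨⋃ C, Hs '' (W C), Set.finite_iUnion fun C => (W C).finite_toSet.image _, ?_, ?_, ?_⟩, ?_⟩
  · intro H hH
    obtain ⟨C, w, hw, rfl⟩ := Set.mem_iUnion.1 hH
    obtain ⟨x, hx⟩ := nonempty_of_mem_componentsOf C.2
    have hw0 : w ≠ 0 := by
      rintro rfl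
      simpa [Hs] using (hmem C x).1 hx 0 hw
    exact ⟨_, setOf_inner_pos_eq_openHemisphere hw0⟩
  · intro C hC
    refine ⟨Hs '' (W ⟨C, hC⟩), Set.subset_iUnion_of_subset ⟨C, hC⟩ subset_rfl, ?_, ?_⟩
    · refine Set.Nonempty.image _ ?_
      -- With no functionals the cone would be the whole space and contain the origin.
      by_contra hne
      rw [Set.not_nonempty_iff_eq_empty, Finset.coe_eq_empty] at hne
      refine zero_notMem_coneOver C ?_
      rw [hW ⟨C, hC⟩, hne]
      simp [openPoly]
    · ext x
      rw [hmem ⟨C, hC⟩]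
      simp
  · intro H hH
    obtain ⟨C, w, hw, rfl⟩ := Set.mem_iUnion.1 hH
    -- Remove the closures of the components not inside the hemisphere; by the dichotomy they lie
    -- where `w` is negative, hence away from its closure.
    let N : Set (Sph n) :=
      (⋃ D ∈ {D : componentsOf U | ¬ PosOn w (coneOver D.1)}, closure D.1)ᶜ
    have hsub : closure (Hs w) ⊆ N := by
      intro x hx hxN
      obtain ⟨D, hD, hxD⟩ := Set.mem_iUnion₂.1 hxN
      exact absurd (hclosure w hx) (not_le.2 ((hsep C w hw D).resolve_left hD x hxD))
    refine ⟨N, IsOpen.mem_nhdsSet ?_ |>.2 hsub, ?_⟩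
    · exact ((Set.toFinite _).isClosed_biUnion fun _ _ => isClosed_closure).isOpen_compl
    · refine Set.Subset.antisymm (Set.inter_subset_inter_right _ (subset_closure.trans hsub)) ?_
      rintro x ⟨hxU, hxN⟩
      refine ⟨hxU, ?_⟩
      obtain ⟨D, hD, hxD⟩ := exists_mem_componentsOf hxU
      by_contra hxH
      exact hxN (Set.mem_biUnion (x := ⟨D, hD⟩) (fun h => hxH (posOn_coneOver_iff.1 h x hxD))
        (subset_closure hxD))
  · intro C hC D hD hne
    -- If all functionals of `C` were positive on `D`, then `D` would meet `C`. The one found is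
    -- nonnegative on the closure of `C` and negative on that of `D`.
    obtain ⟨w, hw, hwD⟩ : ∃ w ∈ W ⟨C, hC⟩, ¬ PosOn w (coneOver D) := by
      by_contra! hcon
      obtain ⟨x, hx⟩ := nonempty_of_mem_componentsOf hD
      exact hne (eq_of_mem_componentsOf hC hD ((hmem ⟨C, hC⟩ x).2
        fun w hw => posOn_coneOver_iff.1 (hcon w hw) x hx) hx)
    rw [Set.disjoint_left]
    intro x hxC hxD
    have h1 := hclosure w (closure_mono (fun y hy => (hmem ⟨C, hC⟩ y).1 hy w hw) hxC)
    have h2 := (hsep ⟨C, hC⟩ w hw ⟨D, hD⟩).resolve_left hwD x hxD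
    exact absurd h1 (not_le.2 h2)
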